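/- Let $\mathbb S=\mathbb R/\mathbb Z$, let $f:\mathbb R^n\times\mathbb R^m\to\mathbb R^n$ be continuously differentiable, let $p\in\mathbb R^m$, $T\in\mathbb R$, let $\rho$ be irrational, and let $v:\mathbb S\times[0,1]\to\mathbb R^n$ be a continuously differentiable solution of $$\partial_\tau v=Tf(v,p),\qquad v(\phi,1)=v(\phi+\rho,0).$$ Let $h_1,h_2$ be two functionals (phase conditions) with $h_1(v,p)=h_2(v,p)=0$, whose variations at $(v,p)$ are $\int_{\mathbb S}\int_0^1 \partial_vh_i(\phi,\tau)\,\delta_v(\phi,\tau)\,d\tau\,d\phi+\partial_ph_i\,\delta_p$ with continuous row-vector kernels $\partial_vh_i$, and suppose that the $2\times2$ matrix $\int_{\mathbb S}\int_0^1\begin{bmatrix}\partial_vh_1\\ \partial_vh_2\end{bmatrix}\begin{bmatrix}\partial_\tau v&\partial_\phi v\end{bmatrix}d\tau\,d\phi$ is nonsingular. Let $V$ solve $\partial_\tau V=T\partial_xf(v,p)V$, $V(\cdot,0)=I_n$. Suppose that $v$ is normally hyperbolic in the following sense: there are $q_\tau,q_\phi:\mathbb S\times[0,1]\to\mathbb R^n$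 such that $q_{\rm tg}:=\partial_\tau v\,q_\tau^{\mathsf T}+\partial_\phi v\,q_\phi^{\mathsf T}$ is a continuous family of projections onto the tangent spaces $\mathrm{span}\{\partial_\tau v,\partial_\phi v\}$ with $q_{\rm tg}(\phi,1)=q_{\rm tg}(\phi+\rho,0)$ and $q_{\rm tg}(\phi,\tau)V(\phi,\tau)=V(\phi,\tau)q_{\rm tg}(\phi,0)$; and, with $q_{\rm tr}:=I_n-q_{\rm tg}$, the map $\Gamma_{\rho,0}[\delta](\phi)=V(\phi-\rho,1)\delta(\phi-\rho)-\delta(\phi)$ is a bijection with bounded inverse (supremum norm) of the space $\{\phi\mapsto q_{\rm tr}(\phi,0)\delta(\phi):\delta\in C(\mathbb S,\mathbb R^n)\}$ onto itself. For $\eta_T,\eta_\rho\in\mathbb R$ consider the adjoint conditions for the unknowns $\lambda_{\rm de}:\mathbb S\times[0,1]\to\mathbb R^n$, $\lambda_{\rm bc}:\mathbb S\to\mathbb R^n$, $\lambda_{\rm ps}\in\mathbb R^2$, $\eta_p\in\mathbb R^m$: $$0=-\partial_\tau\lambda_{\rm de}^{\mathsf T}-T\lambda_{\rm de}^{\mathsf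 T}\partial_xf(v,p)+\lambda_{\rm ps}^{\mathsf T}\partial_vh,\quad 0=\lambda_{\rm de}(\phi,1)-\lambda_{\rm bc}(\phi),\quad 0=-\lambda_{\rm de}(\phi,0)+\lambda_{\rm bc}(\phi-\rho),$$ $$0=-\int_{\mathbb S}\int_0^1\lambda_{\rm de}^{\mathsf T}f(v,p)\,d\tau\,d\phi+\eta_T,\qquad 0=\int_{\mathbb S}\lambda_{\rm bc}^{\mathsf T}(\phi)\,\partial_\phi v(\phi+\rho,0)\,d\phi+\eta_\rho,$$ $$0=-\int_{\mathbb S}\int_0^1\lambda_{\rm de}^{\mathsf T}T\partial_pf(v,p)\,d\tau\,d\phi+\eta_p^{\mathsf T}+\lambda_{\rm ps}^{\mathsf T}\partial_ph .$$ Then: 1. For all $\eta_T,\eta_\rho$, every solution with continuous $\lambda_{\rm bc}$ (in particular every continuous solution) has $\lambda_{\rm ps}=0$ and $$\lambda_{\rm de}(\phi,\tau)=T\eta_T\,q_\tau(\phi,\tau)-\eta_\rho\,q_\phi(\phi,\tau)\quad\text{for all }(\phi,\tau).$$ 2. For $(\eta_T,\eta_\rho)=(1,0)$ there is exactly one solution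 with continuous $\lambda_{\rm bc}$; its $\lambda_{\rm de}$ is continuous and equals $Tq_\tau$. For $(\eta_T,\eta_\rho)=(0,1)$ there is exactly one solution with continuous $\lambda_{\rm bc}$; its $\lambda_{\rm de}$ is continuous and equals $-q_\phi$. 3. The linearized problem has no bounded inverse: for the linear map sending $(\delta_v,\delta_T,\delta_\rho,\delta_p)$, where $\delta_v:\mathbb S\times[0,1]\to\mathbb R^n$ is continuous with continuous $\partial_\tau\delta_v$, to $(\delta_{\rm ode},\delta_{\rm bc},\delta_h,\delta_p)$, $$\delta_{\rm ode}=\partial_\tau\delta_v-T\partial_xf(v,p)\delta_v-f(v,p)\delta_T-T\partial_pf(v,p)\delta_p,\quad \delta_{\rm bc}=\delta_v(\cdot+\rho,0)-\delta_v(\cdot,1)+\partial_\phi v(\cdot+\rho,0)\delta_\rho,$$ $$\delta_h=\int_{\mathbb S}\int_0^1\partial_vh\,\delta_v\,d\tau\,d\phi+\partial_ph\,\delta_p,$$ there is no constant $C$ such that $\|(\delta_v,\delta_T,\delta_\rho,\delta_p)\|\le C\,\|(\delta_{\rm ode},\delta_{\rm bc},\delta_h,\delta_p)\|$ always holds (supremum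 norms). -/

import Mathlib

open MeasureTheory Set

noncomputable section

namespace QPTorus

/-- The circle `𝕊 = ℝ / ℤ`. -/
abbrev Circ : Type := UnitAddCircle

/-- The cylinder `𝕊 × [0,1]`, with points `(φ, τ)`. -/
abbrev Cyl : Type := Circ × unitInterval

/-- The state space `ℝⁿ`, also used for the parameter space `ℝ^m`. -/
abbrev Vec (n : ℕ) : Type := EuclideanSpace ℝ (Fin n)

section Calculus

variable {F : Type*}

/-- The curve `s ↦ w (φ, s)`. It is only ever used for `s ∈ [0,1]`;
outside this interval it is extended by its end values. -/
def slice (w : Cyl → F) (φ : Circ) (s : ℝ) : F :=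
  w (φ, projIcc (0 : ℝ) 1 zero_le_one s)

variable [NormedAddCommGroup F] [NormedSpace ℝ F]

/-- The partial derivative `∂_τ w` (one-sided at `τ = 0` and `τ = 1`). -/
def dTau (w : Cyl → F) (z : Cyl) : F :=
  derivWithin (slice w z.1) (Icc 0 1) (z.2 : ℝ)

/-- The partial derivative `∂_φ w`. -/
def dPhi (w : Cyl → F) (z : Cyl) : F :=
  deriv (fun s : ℝ => w (z.1 + (s : Circ), z.2)) 0

/-- `w` is continuously differentiable on `𝕊 × [0,1]`. -/
def IsC1 (w : Cyl → F) : Prop :=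
  ContDiffOn ℝ 1 (fun x : ℝ × ℝ => slice w (x.1 : Circ) x.2) (univ ×ˢ Icc (0 : ℝ) 1)

/-- `w` has a continuous partial derivative with respect to `τ` on `𝕊 × [0,1]`. -/
def HasContDTau (w : Cyl → F) : Prop :=
  (∀ z : Cyl, DifferentiableWithinAt ℝ (slice w z.1) (Icc 0 1) (z.2 : ℝ)) ∧
    Continuous (dTau w)

end Calculus

/-- The iterated integral `∫_𝕊 ∫_0^1 g(φ,τ) dτ dφ`. -/
def cylInt (g : Cyl → ℝ) : ℝ :=
  ∫ φ : Circ, ∫ s in (0 : ℝ)..1, slice g φ s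

variable {n m : ℕ}

/-- `∂_x f(x,p)`. -/
def dfx (f : Vec n → Vec m → Vec n) (x : Vec n) (p : Vec m) : Vec n →L[ℝ] Vec n :=
  fderiv ℝ (fun y => f y p) x

/-- `∂_p f(x,p)`. -/
def dfp (f : Vec n → Vec m → Vec n) (x : Vec n) (p : Vec m) : Vec m →L[ℝ] Vec n :=
  fderiv ℝ (fun r => f x r) p

/-- `v` is a continuously differentiable solution of the boundary-value problem
`∂_τ v = T f(v,p)`, `v(φ,1) = v(φ+ρ,0)` on `𝕊 × [0,1]`. -/
structure IsTorusSolution (f : Vec n → Vec m → Vec n) (p : Vec m) (T ρ : ℝ)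
    (v : C(Cyl, Vec n)) : Prop where
  c1 : IsC1 v
  ode : ∀ (φ : Circ) (τ : unitInterval),
    HasDerivWithinAt (slice v φ) (T • f (v (φ, τ)) p) (Icc 0 1) (τ : ℝ)
  bc : ∀ φ : Circ, v (φ, 1) = v (φ + (ρ : Circ), 0)

/-- `V` is the solution of the variational initial-value problem
`∂_τ V = T ∂_x f(v,p) V`, `V(·,0) = I`. -/
structure IsVariational (f : Vec n → Vec m → Vec n) (p : Vec m) (T : ℝ)
    (v : C(Cyl, Vec n)) (V : Cyl → Vec n →L[ℝ] Vec n) : Prop where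
  init : ∀ φ : Circ, V (φ, 0) = ContinuousLinearMap.id ℝ (Vec n)
  ode : ∀ (φ : Circ) (τ : unitInterval),
    HasDerivWithinAt (slice V φ) (T • (dfx f (v (φ, τ)) p).comp (V (φ, τ)))
      (Icc 0 1) (τ : ℝ)

/-- The functions `k i` and the linear forms `kp i` are the derivatives `∂_v h_i(v,p)` (as
integral kernels) and `∂_p h_i(v,p)` of the functionals `h_i`: the variation of `h_i` in every
continuously differentiable direction `δ` and every `δp` is
`∫_𝕊 ∫_0^1 k_iᵀ δ dτ dφ + kp_i δp`. -/
def IsPhaseDeriv (h : Fin 2 → C(Cyl, Vec n) → Vec m → ℝ) (v : C(Cyl, Vec n)) (p : Vec m)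
    (k : Fin 2 → C(Cyl, Vec n)) (kp : Fin 2 → Vec m →L[ℝ] ℝ) : Prop :=
  ∀ (i : Fin 2) (δ : C(Cyl, Vec n)) (δp : Vec m), IsC1 δ →
    HasDerivAt (fun s : ℝ => h i (v + s • δ) (p + s • δp))
      (cylInt (fun z => inner ℝ (k i z) (δ z)) + kp i δp) 0

/-- The `2 × 2` matrix `∫_𝕊 ∫_0^1 [∂_v h_1; ∂_v h_2] [∂_τ v, ∂_φ v] dτ dφ`. -/
def phaseMatrix (k : Fin 2 → C(Cyl, Vec n)) (v : C(Cyl, Vec n)) : Matrix (Fin 2) (Fin 2) ℝ :=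
  Matrix.of fun i => ![cylInt (fun z => inner ℝ (k i z) (dTau v z)),
    cylInt (fun z => inner ℝ (k i z) (dPhi v z))]

/-- `q_tg = ∂_τ v q_τᵀ + ∂_φ v q_φᵀ`. -/
def qtg (v : C(Cyl, Vec n)) (qτ qφ : Cyl → Vec n) (z : Cyl) : Vec n →L[ℝ] Vec n :=
  (innerSL ℝ (qτ z)).smulRight (dTau v z) + (innerSL ℝ (qφ z)).smulRight (dPhi v z)

/-- `q_tr = I - q_tg`. -/
def qtr (v : C(Cyl, Vec n)) (qτ qφ : Cyl → Vec n) (z : Cyl) : Vec n →L[ℝ] Vec n :=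
  ContinuousLinearMap.id ℝ (Vec n) - qtg v qτ qφ z

/-- `Γ_{ρ,0}[δ](φ) = V(φ-ρ,1) δ(φ-ρ) - δ(φ)`. -/
def Gam (V : Cyl → Vec n →L[ℝ] Vec n) (ρ : ℝ) (δ : Circ → Vec n) (φ : Circ) : Vec n :=
  V (φ - (ρ : Circ), 1) (δ (φ - (ρ : Circ))) - δ φ

/-- The space of functions `φ ↦ q_tr(φ,0) δ(φ)`, `δ` continuous on `𝕊`. -/
def transversal (v : C(Cyl, Vec n)) (qτ qφ : Cyl → Vec n) : Set (Circ → Vec n) :=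
  {γ | ∃ δ : Circ → Vec n, Continuous δ ∧ γ = fun φ => qtr v qτ qφ (φ, 0) (δ φ)}

/-- The torus `v` is normally hyperbolic, with tangential projection
`q_tg = ∂_τ v q_τᵀ + ∂_φ v q_φᵀ`: the `q_tg` form a continuous invariant family of projections
onto the tangent spaces, and `Γ_{ρ,0}` is a bijection with bounded inverse (in the supremum norm)
on the space of continuous transversal perturbations. -/
structure IsNormallyHyperbolic (ρ : ℝ) (v : C(Cyl, Vec n)) (V : Cyl → Vec n →L[ℝ] Vec n)
    (qτ qφ : Cyl → Vec n) : Prop where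
  cont : Continuous (qtg v qτ qφ)
  idem : ∀ z, (qtg v qτ qφ z).comp (qtg v qτ qφ z) = qtg v qτ qφ z
  range_eq : ∀ z, LinearMap.range (qtg v qτ qφ z).toLinearMap =
    Submodule.span ℝ {dTau v z, dPhi v z}
  shift : ∀ φ : Circ, qtg v qτ qφ (φ, 1) = qtg v qτ qφ (φ + (ρ : Circ), 0)
  invariant : ∀ (φ : Circ) (τ : unitInterval),
    (qtg v qτ qφ (φ, τ)).comp (V (φ, τ)) = (V (φ, τ)).comp (qtg v qτ qφ (φ, 0))
  bijOn : BijOn (Gam V ρ) (transversal v qτ qφ) (transversal v qτ qφ)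
  bounded : ∃ C : ℝ, ∀ δ ∈ transversal v qτ qφ, ∀ ε : ℝ,
    (∀ φ, ‖Gam V ρ δ φ‖ ≤ ε) → ∀ φ, ‖δ φ‖ ≤ C * ε

/-- The unknowns `(λ_de, λ_bc, λ_ps, η_p)` of the adjoint conditions for given `(η_T, η_ρ)`. -/
@[ext]
structure AdjointVars (n m : ℕ) where
  de : Cyl → Vec n
  bc : Circ → Vec n
  ps : Fin 2 → ℝ
  ηp : Vec m

/-- The adjoint conditions, one for each of the variations
`δv(φ,τ)`, `δv(φ,1)`, `δv(φ,0)`, `δT`, `δρ`, `δp`. -/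
structure IsAdjointSolution (f : Vec n → Vec m → Vec n) (p : Vec m) (T ρ : ℝ)
    (v : C(Cyl, Vec n)) (k : Fin 2 → C(Cyl, Vec n)) (kp : Fin 2 → Vec m →L[ℝ] ℝ)
    (ηT ηρ : ℝ) (X : AdjointVars n m) : Prop where
  var_v : ∀ (φ : Circ) (τ : unitInterval),
    HasDerivWithinAt (slice X.de φ)
      (-(T • ContinuousLinearMap.adjoint (dfx f (v (φ, τ)) p) (X.de (φ, τ)))
        + ∑ i, X.ps i • k i (φ, τ)) (Icc 0 1) (τ : ℝ)
  var_v1 : ∀ φ : Circ, 0 = X.de (φ, 1) - X.bc φ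
  var_v0 : ∀ φ : Circ, 0 = -X.de (φ, 0) + X.bc (φ - (ρ : Circ))
  var_T : 0 = -cylInt (fun z => inner ℝ (X.de z) (f (v z) p)) + ηT
  var_ρ : 0 = (∫ φ : Circ, inner ℝ (X.bc φ) (dPhi v (φ + (ρ : Circ), 0))) + ηρ
  var_p : ∀ δp : Vec m,
    0 = -cylInt (fun z => inner ℝ (X.de z) (T • dfp f (v z) p δp)) + inner ℝ X.ηp δp
      + ∑ i, X.ps i * kp i δp

/-- First component of the linearized problem:
`∂_τ δ_v - T ∂_x f(v,p) δ_v - f(v,p) δ_T - T ∂_p f(v,p) δ_p`. -/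
def linOde (f : Vec n → Vec m → Vec n) (p : Vec m) (T : ℝ) (v δv : C(Cyl, Vec n))
    (δT : ℝ) (δp : Vec m) (z : Cyl) : Vec n :=
  dTau δv z - T • dfx f (v z) p (δv z) - δT • f (v z) p - T • dfp f (v z) p δp

/-- Second component of the linearized problem:
`δ_v(φ+ρ,0) - δ_v(φ,1) + ∂_φ v(φ+ρ,0) δ_ρ`. -/
def linBc (ρ : ℝ) (v δv : C(Cyl, Vec n)) (δρ : ℝ) (φ : Circ) : Vec n :=
  δv (φ + (ρ : Circ), 0) - δv (φ, 1) + δρ • dPhi v (φ + (ρ : Circ), 0)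

/-- Third component of the linearized problem:
`∫_𝕊 ∫_0^1 ∂_v h_i δ_v dτ dφ + ∂_p h_i δ_p`. -/
def linPhase (k : Fin 2 → C(Cyl, Vec n)) (kp : Fin 2 → Vec m →L[ℝ] ℝ) (δv : C(Cyl, Vec n))
    (δp : Vec m) (i : Fin 2) : ℝ :=
  cylInt (fun z => inner ℝ (k i z) (δv z)) + kp i δp

/-- The estimate `‖(δ_v, δ_T, δ_ρ, δ_p)‖ ≤ C ‖(δ_ode, δ_bc, δ_h, δ_p)‖` (supremum norms) for the
linearized problem `(δ_v, δ_T, δ_ρ, δ_p) ↦ (δ_ode, δ_bc, δ_h, δ_p)` on the space of continuous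
`δ_v` with continuous `∂_τ δ_v`. Any bounded inverse (or merely bounded left inverse) of the
linearized problem yields it. -/
def LinearizationBound (f : Vec n → Vec m → Vec n) (p : Vec m) (T ρ : ℝ)
    (v : C(Cyl, Vec n)) (k : Fin 2 → C(Cyl, Vec n)) (kp : Fin 2 → Vec m →L[ℝ] ℝ)
    (C : ℝ) : Prop :=
  ∀ (δv : C(Cyl, Vec n)) (δT δρ : ℝ) (δp : Vec m) (ε : ℝ), HasContDTau δv →
    (∀ z, ‖linOde f p T v δv δT δp z‖ ≤ ε) →
    (∀ φ, ‖linBc ρ v δv δρ φ‖ ≤ ε) →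
    (∀ i, |linPhase k kp δv δp i| ≤ ε) →
    ‖δp‖ ≤ ε →
    (∀ z, ‖δv z‖ ≤ C * ε) ∧ |δT| ≤ C * ε ∧ |δρ| ≤ C * ε ∧ ‖δp‖ ≤ C * ε

end QPTorus

end

/-!
Write `A = T ∂_x f(v,p)`. The tangent fields `∂_τ v` and `∂_φ v` solve `∂_τ w = A w` and respect
the gluing `(φ,1) ∼ (φ+ρ,0)`. By uniqueness for linear equations, the zero set of such a field over
`τ = 0` is invariant under the rotation by `ρ`, which is minimal, so a field that vanishes somewhere
vanishes identically. Nonsingularity of the phase matrix therefore makes `∂_τ v` and `∂_φ v`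
independent at every point.

Pairing the adjoint equation with the two tangent fields and integrating, the boundary terms cancel
and `λ_psᵀ` times the phase matrix is zero, so `λ_ps = 0`. The pairings are then constant along
`τ` and invariant under the rotation, hence constant, with the values `T η_T` and `-η_ρ` prescribed
by the two integral conditions. In the transversal directions, `λ(·,0)` integrates to zero against
the range of `Γ`, which is everything of the form `q_tr δ`; testing with `δ = q_trᵀ λ` gives
`q_trᵀ λ = 0`. Hence `λ = T η_T q_τ - η_ρ q_φ` at `τ = 0`, and everywhere by transport with `V`.

For the last part, a Fourier mode `g` with `g(φ+ρ) - g(φ)` uniformly small makes `g ∂_φ v` an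
approximate null vector of the linearized problem.
-/

noncomputable section

namespace QPTorus

open scoped RealInnerProductSpace Matrix

section Rotation

lemma eq_univ_of_add_mem_iff {G : Type*} [AddGroup G] [TopologicalSpace G] [ContinuousAdd G]
    {a : G} (ha : DenseRange fun j : ℤ => j • a) {S : Set G} (hS : IsClosed S)
    (hne : S.Nonempty) (hinv : ∀ x, x + a ∈ S ↔ x ∈ S) : S = univ := by
  obtain ⟨x, hx⟩ := hne
  have hdense : DenseRange fun j : ℤ => x + j • a :=
    (Homeomorph.addLeft x).surjective.denseRange.comp ha (Homeomorph.addLeft x).continuous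
  have hperiodic : Function.Periodic (· ∈ S) a := fun y => propext (hinv y)
  have hsub : range (fun j : ℤ => x + j • a) ⊆ S :=
    range_subset_iff.2 fun j => (hperiodic.zsmul j x).mpr hx
  rw [← hS.closure_eq]
  exact (Dense.mono hsub hdense).closure_eq

lemma eq_of_periodic_of_denseRange {G Y : Type*} [AddGroup G] [TopologicalSpace G]
    [ContinuousAdd G] [TopologicalSpace Y] [T1Space Y] {a : G}
    (ha : DenseRange fun j : ℤ => j • a) {g : G → Y} (hg : Continuous g)
    (hper : Function.Periodic g a) (x y : G) : g x = g y := by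
  have hfibre : g ⁻¹' {g y} = univ :=
    eq_univ_of_add_mem_iff ha (isClosed_singleton.preimage hg) ⟨y, rfl⟩ fun z => by
      simp only [mem_preimage, mem_singleton_iff, hper z]
  exact (hfibre ▸ mem_univ x : x ∈ g ⁻¹' {g y})

lemma denseRange_zsmul_coe {ρ : ℝ} (hρ : Irrational ρ) :
    DenseRange fun j : ℤ => j • (ρ : Circ) :=
  AddCircle.denseRange_zsmul_coe_iff.2 (by simpa only [div_one] using hρ)

lemma exists_norm_fourier_sub_one_le (x : Circ) {ε : ℝ} (hε : 0 < ε) :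
    ∃ j : ℕ, 0 < j ∧ ‖(fourier j x : ℂ) - 1‖ ≤ ε := by
  have hcont : Continuous fun y : Circ => (AddCircle.toCircle y : ℂ) :=
    continuous_subtype_val.comp AddCircle.continuous_toCircle
  obtain ⟨r, hr, hball⟩ := Metric.continuous_iff.1 hcont 0 ε hε
  obtain ⟨N, hN⟩ := exists_nat_one_div_lt hr
  obtain ⟨j, hj, hjx⟩ := AddCircle.exists_norm_nsmul_le x (Nat.succ_pos N)
  refine ⟨j, hj.1, ?_⟩
  have hsmall : dist (j • x) 0 < r := by
    rw [dist_zero_right]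
    refine lt_of_le_of_lt hjx (lt_of_le_of_lt ?_ hN)
    push_cast
    gcongr
    linarith
  have hdist := (hball (j • x) hsmall).le
  rwa [dist_eq_norm, AddCircle.toCircle_zero, Circle.coe_one, ← natCast_zsmul,
    ← fourier_apply] at hdist

/-- By Dirichlet's approximation theorem some nontrivial character is nearly invariant under the
translation by `x`; `g` is its real part. -/
lemma exists_almost_invariant (x : Circ) {ε : ℝ} (hε : 0 < ε) :
    ∃ g : C(Circ, ℝ), (∀ φ, |g (φ + x) - g φ| ≤ ε) ∧ (∃ φ, g φ = 1) ∧ ∃ φ, g φ = -1 := by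
  obtain ⟨j, hj, hjx⟩ := exists_norm_fourier_sub_one_le x hε
  let g : C(Circ, ℝ) := ⟨fun φ => (fourier j φ : ℂ).re, by fun_prop⟩
  refine ⟨g, fun φ => ?_, ⟨0, ?_⟩, ⟨0 + ((1 / 2 / (j : ℤ) : ℝ) : Circ), ?_⟩⟩
  · have hmul : (fourier j (φ + x) : ℂ) - fourier j φ = fourier j φ * (fourier j x - 1) := by
      simp only [fourier_apply, smul_add, AddCircle.toCircle_add, Circle.coe_mul]
      ring
    calc |g (φ + x) - g φ| = |((fourier j (φ + x) : ℂ) - fourier j φ).re| := by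
          rw [Complex.sub_re]; rfl
      _ ≤ ‖(fourier j (φ + x) : ℂ) - fourier j φ‖ := Complex.abs_re_le_norm _
      _ = ‖(fourier j x : ℂ) - 1‖ := by
          rw [hmul, norm_mul, fourier_apply, Circle.norm_coe, one_mul]
      _ ≤ ε := hjx
  · change (fourier j (0 : Circ) : ℂ).re = 1
    rw [fourier_eval_zero, Complex.one_re]
  · change (fourier j (0 + ((1 / 2 / (j : ℤ) : ℝ) : Circ)) : ℂ).re = -1
    rw [fourier_add_half_inv_index (by exact_mod_cast hj.ne') one_pos, fourier_eval_zero,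
      Complex.neg_re, Complex.one_re]

end Rotation

section Slices

variable {F : Type*}

@[simp]
lemma slice_coe (w : Cyl → F) (φ : Circ) (τ : unitInterval) : slice w φ (τ : ℝ) = w (φ, τ) := by
  rw [slice, projIcc_val]

lemma slice_of_mem (w : Cyl → F) (φ : Circ) {t : ℝ} (ht : t ∈ Icc (0 : ℝ) 1) :
    slice w φ t = w (φ, ⟨t, ht⟩) :=
  slice_coe w φ ⟨t, ht⟩

lemma continuous_slice_uncurry [TopologicalSpace F] {w : Cyl → F} (hw : Continuous w) :
    Continuous (Function.uncurry (slice w)) :=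
  hw.comp (continuous_fst.prodMk (continuous_projIcc.comp continuous_snd))

lemma continuous_slice [TopologicalSpace F] {w : Cyl → F} (hw : Continuous w) (φ : Circ) :
    Continuous (slice w φ) :=
  (continuous_slice_uncurry hw).comp (Continuous.prodMk_right φ)

variable [NormedAddCommGroup F] [NormedSpace ℝ F]

lemma dTau_eq_of_hasDerivWithinAt {w : Cyl → F} {φ : Circ} {τ : unitInterval} {w' : F}
    (hw : HasDerivWithinAt (slice w φ) w' (Icc 0 1) (τ : ℝ)) : dTau w (φ, τ) = w' :=
  hw.derivWithin (uniqueDiffOn_Icc zero_lt_one _ τ.2)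

lemma hasDerivWithinAt_slice_of_mem {w g : Cyl → F} {φ : Circ}
    (hw : ∀ τ : unitInterval, HasDerivWithinAt (slice w φ) (g (φ, τ)) (Icc 0 1) (τ : ℝ))
    {t : ℝ} (ht : t ∈ Icc (0 : ℝ) 1) :
    HasDerivWithinAt (slice w φ) (slice g φ t) (Icc 0 1) t := by
  rw [slice_of_mem g φ ht]
  exact hw ⟨t, ht⟩

lemma sub_eq_integral_slice [CompleteSpace F] {w g : Cyl → F} {φ : Circ}
    (hw : ∀ τ : unitInterval, HasDerivWithinAt (slice w φ) (g (φ, τ)) (Icc 0 1) (τ : ℝ))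
    (hg : Continuous (slice g φ)) (τ : unitInterval) :
    w (φ, τ) - w (φ, 0) = ∫ t in (0 : ℝ)..τ, slice g φ t := by
  have hcont : ContinuousOn (slice w φ) (Icc 0 τ) := fun t ht =>
    ((hasDerivWithinAt_slice_of_mem hw ⟨ht.1, ht.2.trans τ.2.2⟩).continuousWithinAt).mono
      (Icc_subset_Icc_right τ.2.2)
  have hderiv : ∀ t ∈ Ioo (0 : ℝ) τ, HasDerivAt (slice w φ) (slice g φ t) t := fun t ht =>
    (hasDerivWithinAt_slice_of_mem hw ⟨ht.1.le, ht.2.le.trans τ.2.2⟩).hasDerivAt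
      (Icc_mem_nhds ht.1 (ht.2.trans_le τ.2.2))
  rw [intervalIntegral.integral_eq_sub_of_hasDerivAt_of_le τ.2.1 hcont hderiv
    (hg.intervalIntegrable _ _), slice_coe, ← slice_coe w φ 0, Icc.coe_zero]

end Slices

section Integral

lemma continuous_sliceIntegral {g : Cyl → ℝ} (hg : Continuous g) :
    Continuous fun φ : Circ => ∫ s in (0 : ℝ)..1, slice g φ s :=
  intervalIntegral.continuous_parametric_intervalIntegral_of_continuous'
    (continuous_slice_uncurry hg) 0 1

lemma integrable_circ {g : Circ → ℝ} (hg : Continuous g) : Integrable g :=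
  hg.integrable_of_hasCompactSupport (HasCompactSupport.of_compactSpace g)

lemma cylInt_add {g g' : Cyl → ℝ} (hg : Continuous g) (hg' : Continuous g') :
    cylInt (fun z => g z + g' z) = cylInt g + cylInt g' := by
  unfold cylInt
  rw [← integral_add (integrable_circ (continuous_sliceIntegral hg))
    (integrable_circ (continuous_sliceIntegral hg'))]
  exact integral_congr_ae (.of_forall fun φ => intervalIntegral.integral_add
    ((continuous_slice hg φ).intervalIntegrable _ _)
    ((continuous_slice hg' φ).intervalIntegrable _ _))

lemma cylInt_const_mul (c : ℝ) (g : Cyl → ℝ) : cylInt (fun z => c * g z) = c * cylInt g := by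
  unfold cylInt
  rw [← integral_const_mul]
  exact integral_congr_ae (.of_forall fun φ => intervalIntegral.integral_const_mul c _)

lemma cylInt_const (c : ℝ) : cylInt (fun _ => c) = c := by
  simp [cylInt, slice, Measure.real, AddCircle.measure_univ]

end Integral

section LinearEquation

variable {F : Type*} [NormedAddCommGroup F] [NormedSpace ℝ F]

lemma eq_zero_of_norm_deriv_le {w w' : ℝ → F} {a b t₀ K : ℝ}
    (hw : ∀ t ∈ Icc a b, HasDerivWithinAt w (w' t) (Icc a b) t)
    (hbound : ∀ t ∈ Icc a b, ‖w' t‖ ≤ K * ‖w t‖) (ht₀ : t₀ ∈ Icc a b) (h0 : w t₀ = 0)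
    {t : ℝ} (ht : t ∈ Icc a b) : w t = 0 := by
  rcases le_total t₀ t with hle | hle
  · refine eq_zero_of_abs_deriv_le_mul_abs_self_of_eq_zero_right (a := t₀) (b := b)
      (fun s hs => ((hw s ⟨ht₀.1.trans hs.1, hs.2⟩).continuousWithinAt).mono
        (Icc_subset_Icc_left ht₀.1)) (fun s hs => ?_) h0
      (fun s hs => hbound s ⟨ht₀.1.trans hs.1, hs.2.le⟩) t ⟨hle, ht.2⟩
    exact (hw s ⟨ht₀.1.trans hs.1, hs.2.le⟩).mono_of_mem_nhdsWithin
      (Filter.mem_of_superset (Icc_mem_nhdsGE hs.2) (Icc_subset_Icc_left (ht₀.1.trans hs.1)))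
  · have hneg : ∀ s ∈ Icc (-t₀) (-a), -s ∈ Icc a b := fun s hs =>
      ⟨by linarith [hs.2], by linarith [hs.1, ht₀.2]⟩
    have hreflect : ∀ s ∈ Icc (-t₀) (-a), HasDerivWithinAt (fun r => w (-r)) (-w' (-s))
        (Icc (-t₀) (-a)) s := fun s hs => by
      simpa only [Function.comp_def, neg_one_smul] using
        (hw _ (hneg s hs)).scomp s (hasDerivAt_neg s).hasDerivWithinAt hneg
    rw [← neg_neg t]
    refine eq_zero_of_abs_deriv_le_mul_abs_self_of_eq_zero_right (f := fun r => w (-r))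
      (f' := fun s => -w' (-s)) (K := K) (a := -t₀) (b := -a)
      (fun s hs => (hreflect s hs).continuousWithinAt)
      (fun s hs => ?_) (by rwa [neg_neg])
      (fun s hs => ?_) (-t) ⟨neg_le_neg hle, neg_le_neg ht.1⟩
    · exact (hreflect s ⟨hs.1, hs.2.le⟩).mono_of_mem_nhdsWithin
        (Filter.mem_of_superset (Icc_mem_nhdsGE hs.2) (Icc_subset_Icc_left hs.1))
    · rw [norm_neg]
      exact hbound _ (hneg s ⟨hs.1, hs.2.le⟩)

/-- `w` solves the linear differential equation `∂_τ w = A w` along the segment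
`{φ} × [0,1]`. -/
def IsLinearSolution (A : Cyl → F →L[ℝ] F) (w : Cyl → F) (φ : Circ) : Prop :=
  ∀ τ : unitInterval, HasDerivWithinAt (slice w φ) (A (φ, τ) (w (φ, τ))) (Icc 0 1) (τ : ℝ)

variable {A : Cyl → F →L[ℝ] F} {w w₁ w₂ : Cyl → F} {φ : Circ}

lemma IsLinearSolution.add (h₁ : IsLinearSolution A w₁ φ) (h₂ : IsLinearSolution A w₂ φ) :
    IsLinearSolution A (w₁ + w₂) φ := fun τ =>
  ((h₁ τ).add (h₂ τ)).congr_deriv (map_add _ _ _).symm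

lemma IsLinearSolution.const_smul (h : IsLinearSolution A w φ) (c : ℝ) :
    IsLinearSolution A (c • w) φ := fun τ =>
  ((h τ).const_smul c).congr_deriv (map_smul _ _ _).symm

lemma IsLinearSolution.eq_zero (h : IsLinearSolution A w φ) (hA : Continuous A)
    {τ₀ : unitInterval} (h0 : w (φ, τ₀) = 0) (τ : unitInterval) : w (φ, τ) = 0 := by
  obtain ⟨K, hK⟩ := isCompact_univ.exists_bound_of_continuousOn hA.continuousOn
  rw [← slice_coe w φ τ]
  refine eq_zero_of_norm_deriv_le (w' := slice (fun z => A z (w z)) φ) (K := K)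
    (fun t ht => hasDerivWithinAt_slice_of_mem (g := fun z => A z (w z)) h ht) (fun t _ => ?_) τ₀.2
    (by rwa [slice_coe]) τ.2
  exact (A _).le_of_opNorm_le (hK _ (mem_univ _)) _

lemma IsLinearSolution.eq (h₁ : IsLinearSolution A w₁ φ) (h₂ : IsLinearSolution A w₂ φ)
    (hA : Continuous A) {τ₀ : unitInterval} (h0 : w₁ (φ, τ₀) = w₂ (φ, τ₀))
    (τ : unitInterval) : w₁ (φ, τ) = w₂ (φ, τ) := by
  have hsub := (h₁.add (h₂.const_smul (-1))).eq_zero hA (τ₀ := τ₀) (by simp [h0]) τ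
  simpa [← sub_eq_add_neg, sub_eq_zero] using hsub

/-- `w` is a continuous solution of `∂_τ w = A w` on the whole cylinder that is compatible with
the gluing `(φ,1) ∼ (φ+ρ,0)`, that is, a solution on the torus. -/
structure IsInvariantField (A : Cyl → F →L[ℝ] F) (ρ : ℝ) (w : Cyl → F) : Prop where
  continuous : Continuous w
  ode : ∀ φ, IsLinearSolution A w φ
  shift : ∀ φ : Circ, w (φ, 1) = w (φ + (ρ : Circ), 0)

variable {ρ : ℝ}

lemma IsInvariantField.add (h₁ : IsInvariantField A ρ w₁) (h₂ : IsInvariantField A ρ w₂) :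
    IsInvariantField A ρ (w₁ + w₂) where
  continuous := h₁.continuous.add h₂.continuous
  ode φ := (h₁.ode φ).add (h₂.ode φ)
  shift φ := by simp only [Pi.add_apply, h₁.shift, h₂.shift]

lemma IsInvariantField.const_smul (h : IsInvariantField A ρ w) (c : ℝ) :
    IsInvariantField A ρ (c • w) where
  continuous := h.continuous.const_smul c
  ode φ := (h.ode φ).const_smul c
  shift φ := by simp only [Pi.smul_apply, h.shift]

lemma IsInvariantField.eq_zero (h : IsInvariantField A ρ w) (hA : Continuous A)
    (hρ : Irrational ρ) {z₀ : Cyl} (h0 : w z₀ = 0) : w = 0 := by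
  have hzeros : (fun φ => w (φ, 0)) ⁻¹' {0} = univ := by
    refine eq_univ_of_add_mem_iff (denseRange_zsmul_coe hρ)
      (isClosed_singleton.preimage (h.continuous.comp (Continuous.prodMk_left 0)))
      ⟨z₀.1, (h.ode z₀.1).eq_zero hA h0 0⟩ fun φ => ?_
    simp only [mem_preimage, mem_singleton_iff, ← h.shift]
    exact ⟨fun h1 => (h.ode φ).eq_zero hA h1 0, fun h0 => (h.ode φ).eq_zero hA h0 1⟩
  have hstart : ∀ φ, w (φ, 0) = 0 := eq_univ_iff_forall.1 hzeros
  exact funext fun z => (h.ode z.1).eq_zero hA (hstart z.1) z.2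

end LinearEquation

section PartialPhi

variable {F : Type*} [NormedAddCommGroup F] [NormedSpace ℝ F]

lemma hasDerivAt_add_coe {w : Cyl → F} (hw : IsC1 w) (x : ℝ) (τ : unitInterval) :
    HasDerivAt (fun s : ℝ => w ((x : Circ) + (s : Circ), τ))
      (fderivWithin ℝ (fun x : ℝ × ℝ => slice w (x.1 : Circ) x.2) (univ ×ˢ Icc (0 : ℝ) 1)
        (x, τ) (1, 0)) 0 := by
  have hlift : HasFDerivWithinAt (fun x : ℝ × ℝ => slice w (x.1 : Circ) x.2)
      (fderivWithin ℝ (fun x : ℝ × ℝ => slice w (x.1 : Circ) x.2) (univ ×ˢ Icc (0 : ℝ) 1)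
        (x, τ)) (univ ×ˢ Icc (0 : ℝ) 1) (x + 0, (τ : ℝ)) := by
    rw [add_zero]
    exact ((hw.differentiableOn one_ne_zero) (x, τ) ⟨mem_univ _, τ.2⟩).hasFDerivWithinAt
  have hline : HasDerivWithinAt (fun s : ℝ => (x + s, (τ : ℝ))) ((1 : ℝ), (0 : ℝ)) univ 0 :=
    (((hasDerivAt_id (0 : ℝ)).const_add x).prodMk (hasDerivAt_const _ _)).hasDerivWithinAt
  have hmaps : MapsTo (fun s : ℝ => (x + s, (τ : ℝ))) univ (univ ×ˢ Icc (0 : ℝ) 1) :=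
    fun s _ => ⟨mem_univ _, τ.2⟩
  refine ((hlift.comp_hasDerivWithinAt (0 : ℝ) hline hmaps).hasDerivAt
    Filter.univ_mem).congr_of_eventuallyEq (.of_forall fun s => ?_)
  simp only [Function.comp_apply, slice_coe, AddCircle.coe_add]

lemma hasDerivAt_dPhi {w : Cyl → F} (hw : IsC1 w) (φ : Circ) (τ : unitInterval) (s : ℝ) :
    HasDerivAt (fun s : ℝ => w (φ + (s : Circ), τ)) (dPhi w (φ + (s : Circ), τ)) s := by
  obtain ⟨x, rfl⟩ := QuotientAddGroup.mk_surjective φ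
  have hshifted : HasDerivAt (fun r : ℝ => w (((x + s : ℝ) : Circ) + (r : Circ), τ))
      (dPhi w (((x + s : ℝ) : Circ), τ)) (s - s) := by
    rw [sub_self]
    exact (hasDerivAt_add_coe hw (x + s) τ).differentiableAt.hasDerivAt
  refine (hshifted.comp_sub_const s s).congr_of_eventuallyEq (.of_forall fun r => ?_)
  change w ((x : Circ) + (r : Circ), τ) = w (((x + s : ℝ) : Circ) + ((r - s : ℝ) : Circ), τ)
  rw [← AddCircle.coe_add, ← AddCircle.coe_add, add_assoc, add_sub_cancel]

lemma continuous_dPhi {w : Cyl → F} (hw : IsC1 w) : Continuous (dPhi w) := by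
  have hquot : IsOpenQuotientMap (Prod.map ((↑) : ℝ → Circ) (id : unitInterval → unitInterval)) :=
    QuotientAddGroup.isOpenQuotientMap_mk.prodMap IsOpenQuotientMap.id
  refine hquot.isQuotientMap.continuous_iff.2 ?_
  have hunique : UniqueDiffOn ℝ (univ ×ˢ Icc (0 : ℝ) 1 : Set (ℝ × ℝ)) :=
    uniqueDiffOn_univ.prod (uniqueDiffOn_Icc zero_lt_one)
  have hlift := (hw.continuousOn_fderivWithin hunique le_rfl).clm_apply
    (continuousOn_const (c := ((1 : ℝ), (0 : ℝ))))
  exact (hlift.comp_continuous (f := fun z : ℝ × unitInterval => (z.1, (z.2 : ℝ)))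
    (by fun_prop) fun z => ⟨mem_univ _, z.2.2⟩).congr
      fun z => (hasDerivAt_add_coe hw z.1 z.2).deriv.symm

lemma dPhi_one_eq_of_shift {w : Cyl → F} {ρ : ℝ} (hw : ∀ φ : Circ, w (φ, 1) = w (φ + (ρ : Circ), 0))
    (φ : Circ) : dPhi w (φ, 1) = dPhi w (φ + (ρ : Circ), 0) := by
  simp only [dPhi, hw, add_right_comm]

lemma hasDerivAt_integral_slice {g g' : Cyl → F} (hg : Continuous g) (hg' : Continuous g')
    (hd : ∀ (φ : Circ) (τ : unitInterval) (s : ℝ),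
      HasDerivAt (fun s : ℝ => g (φ + (s : Circ), τ)) (g' (φ + (s : Circ), τ)) s)
    (φ : Circ) (b : ℝ) :
    HasDerivAt (fun s : ℝ => ∫ t in (0 : ℝ)..b, slice g (φ + (s : Circ)) t)
      (∫ t in (0 : ℝ)..b, slice g' φ t) 0 := by
  obtain ⟨K, hK⟩ := isCompact_univ.exists_bound_of_continuousOn hg'.continuousOn
  have h := (intervalIntegral.hasDerivAt_integral_of_dominated_loc_of_deriv_le
    (μ := volume) (a := 0) (b := b) (x₀ := (0 : ℝ))
    (F := fun (s : ℝ) t => slice g (φ + (s : Circ)) t)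
    (F' := fun (s : ℝ) t => slice g' (φ + (s : Circ)) t)
    (bound := fun _ => K) Filter.univ_mem
    (.of_forall fun s => (continuous_slice hg _).aestronglyMeasurable)
    ((continuous_slice hg _).intervalIntegrable _ _)
    (continuous_slice hg' _).aestronglyMeasurable
    (.of_forall fun t _ s _ => hK _ (mem_univ _))
    intervalIntegrable_const (.of_forall fun t _ s _ => hd φ _ s)).2
  simpa only [AddCircle.coe_zero, add_zero] using h

end PartialPhi

section Linearization

variable {F : Type*} [NormedAddCommGroup F] [NormedSpace ℝ F] {G : F → F} {w : C(Cyl, F)}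

lemma isLinearSolution_dTau (hG : Differentiable ℝ G) {φ : Circ}
    (hode : ∀ τ : unitInterval,
      HasDerivWithinAt (slice w φ) (G (w (φ, τ))) (Icc 0 1) (τ : ℝ)) :
    IsLinearSolution (fun z => fderiv ℝ G (w z)) (dTau w) φ := fun τ => by
  have hdTau : ∀ τ : unitInterval, dTau w (φ, τ) = G (w (φ, τ)) := fun τ =>
    dTau_eq_of_hasDerivWithinAt (hode τ)
  have hG' : HasFDerivAt G (fderiv ℝ G (w (φ, τ))) (slice w φ τ) := by
    rw [slice_coe]
    exact (hG _).hasFDerivAt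
  rw [hdTau]
  exact (hG'.comp_hasDerivWithinAt (τ : ℝ) (hode τ)).congr_of_mem (fun t _ => hdTau _) τ.2

lemma dPhi_eq_add_integral [CompleteSpace F] (hG : ContDiff ℝ 1 G) (hw : IsC1 w)
    (hode : ∀ (φ : Circ) (τ : unitInterval),
      HasDerivWithinAt (slice w φ) (G (w (φ, τ))) (Icc 0 1) (τ : ℝ))
    (φ : Circ) (τ : unitInterval) :
    dPhi w (φ, τ) = dPhi w (φ, 0) +
      ∫ t in (0 : ℝ)..τ, slice (fun z => fderiv ℝ G (w z) (dPhi w z)) φ t := by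
  have hGw : Continuous fun z => G (w z) := hG.continuous.comp w.continuous
  have hdGw : Continuous fun z => fderiv ℝ G (w z) (dPhi w z) :=
    ((hG.continuous_fderiv one_ne_zero).comp w.continuous).clm_apply (continuous_dPhi hw)
  have hintegral := hasDerivAt_integral_slice hGw hdGw (fun φ τ s =>
    (hG.differentiable one_ne_zero _).hasFDerivAt.comp_hasDerivAt s (hasDerivAt_dPhi hw φ τ s))
    φ τ
  have hsum : HasDerivAt (fun s : ℝ => w (φ + (s : Circ), τ))
      (dPhi w (φ + ((0 : ℝ) : Circ), 0) +
        ∫ t in (0 : ℝ)..τ, slice (fun z => fderiv ℝ G (w z) (dPhi w z)) φ t) 0 := by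
    refine ((hasDerivAt_dPhi hw φ 0 0).add hintegral).congr_of_eventuallyEq
      (.of_forall fun s => ?_)
    exact eq_add_of_sub_eq'
      (sub_eq_integral_slice (g := fun z => G (w z)) (hode _) (continuous_slice hGw _) τ)
  simpa only [AddCircle.coe_zero, add_zero] using (hasDerivAt_dPhi hw φ τ 0).unique hsum

lemma isLinearSolution_dPhi [CompleteSpace F] (hG : ContDiff ℝ 1 G) (hw : IsC1 w)
    (hode : ∀ (φ : Circ) (τ : unitInterval),
      HasDerivWithinAt (slice w φ) (G (w (φ, τ))) (Icc 0 1) (τ : ℝ)) (φ : Circ) :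
    IsLinearSolution (fun z => fderiv ℝ G (w z)) (dPhi w) φ := fun τ => by
  have hcont : Continuous (slice (fun z => fderiv ℝ G (w z) (dPhi w z)) φ) :=
    continuous_slice (((hG.continuous_fderiv one_ne_zero).comp w.continuous).clm_apply
      (continuous_dPhi hw)) φ
  have hprimitive := ((hcont.integral_hasStrictDerivAt 0 (τ : ℝ)).hasDerivAt.const_add
    (dPhi w (φ, 0))).hasDerivWithinAt (s := Icc 0 1)
  rw [slice_coe] at hprimitive
  refine hprimitive.congr_of_mem (fun t ht => ?_) τ.2
  rw [slice_of_mem _ φ ht, dPhi_eq_add_integral hG hw hode φ ⟨t, ht⟩]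

end Linearization

section TorusField

variable {n m : ℕ} {f : Vec n → Vec m → Vec n} {p : Vec m} {T ρ : ℝ} {v : C(Cyl, Vec n)}

/-- The coefficient `T ∂_x f(v,p)` of the variational equation. -/
def jacobian (f : Vec n → Vec m → Vec n) (p : Vec m) (T : ℝ) (v : C(Cyl, Vec n)) (z : Cyl) :
    Vec n →L[ℝ] Vec n :=
  T • dfx f (v z) p

lemma continuous_jacobian (hf : ContDiff ℝ 1 fun y => f y p) (T : ℝ) (v : C(Cyl, Vec n)) :
    Continuous (jacobian f p T v) :=
  ((hf.continuous_fderiv one_ne_zero).comp v.continuous).const_smul T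

lemma fderiv_const_smul_eq_jacobian (f : Vec n → Vec m → Vec n) (p : Vec m) (T : ℝ)
    (v : C(Cyl, Vec n)) :
    (fun z => fderiv ℝ (fun y => T • f y p) (v z)) = jacobian f p T v :=
  funext fun _ => congrFun (fderiv_const_smul_field T) _

lemma continuous_dfp (hf : ContDiff ℝ 1 fun x : Vec n × Vec m => f x.1 x.2) (p : Vec m) :
    Continuous fun x => dfp f x p := by
  have hpartial : ∀ x, dfp f x p = (fderiv ℝ (fun x : Vec n × Vec m => f x.1 x.2) (x, p)).comp
      (ContinuousLinearMap.inr ℝ (Vec n) (Vec m)) := fun x =>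
    (((hf.differentiable one_ne_zero (x, p)).hasFDerivAt).comp p
      (hasFDerivAt_prodMk_right x p)).fderiv
  simp only [hpartial]
  exact ((hf.continuous_fderiv one_ne_zero).comp (Continuous.prodMk_left p)).clm_comp
    continuous_const

lemma IsTorusSolution.dTau_eq (hv : IsTorusSolution f p T ρ v) (z : Cyl) :
    dTau v z = T • f (v z) p :=
  dTau_eq_of_hasDerivWithinAt (hv.ode z.1 z.2)

lemma IsTorusSolution.isInvariantField_dTau (hv : IsTorusSolution f p T ρ v)
    (hf : ContDiff ℝ 1 fun y => f y p) : IsInvariantField (jacobian f p T v) ρ (dTau v) where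
  continuous := by
    rw [funext hv.dTau_eq]
    exact (hf.continuous.comp v.continuous).const_smul T
  ode φ := fderiv_const_smul_eq_jacobian f p T v ▸
    isLinearSolution_dTau ((hf.differentiable one_ne_zero).const_smul T) (hv.ode φ)
  shift φ := by rw [hv.dTau_eq, hv.dTau_eq, hv.bc]

lemma IsTorusSolution.isInvariantField_dPhi (hv : IsTorusSolution f p T ρ v)
    (hf : ContDiff ℝ 1 fun y => f y p) : IsInvariantField (jacobian f p T v) ρ (dPhi v) where
  continuous := continuous_dPhi hv.c1
  ode := fderiv_const_smul_eq_jacobian f p T v ▸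
    isLinearSolution_dPhi (hf.const_smul T) hv.c1 hv.ode
  shift := dPhi_one_eq_of_shift hv.bc

end TorusField

section FundamentalSolution

variable {F : Type*} [NormedAddCommGroup F] [NormedSpace ℝ F] {A V : Cyl → F →L[ℝ] F}

/-- `V` is the family of fundamental solutions of `∂_τ w = A w`, normalized to be the identity at
`τ = 0`. -/
structure IsFundamentalSolution (A V : Cyl → F →L[ℝ] F) : Prop where
  init : ∀ φ : Circ, V (φ, 0) = ContinuousLinearMap.id ℝ F
  ode : ∀ (φ : Circ) (τ : unitInterval),
    HasDerivWithinAt (slice V φ) ((A (φ, τ)).comp (V (φ, τ))) (Icc 0 1) (τ : ℝ)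

lemma IsFundamentalSolution.isLinearSolution_apply (hV : IsFundamentalSolution A V) (u : F)
    (φ : Circ) : IsLinearSolution A (fun z => V z u) φ := fun τ =>
  ((hV.ode φ τ).clm_apply (hasDerivWithinAt_const (τ : ℝ) (Icc (0 : ℝ) 1) u)).congr_deriv
    (by rw [map_zero, add_zero, ContinuousLinearMap.comp_apply])

lemma IsFundamentalSolution.apply_eq (hV : IsFundamentalSolution A V) (hA : Continuous A)
    {w : Cyl → F} {φ : Circ} (hw : IsLinearSolution A w φ) (τ : unitInterval) :
    V (φ, τ) (w (φ, 0)) = w (φ, τ) :=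
  (hV.isLinearSolution_apply (w (φ, 0)) φ).eq hw hA (τ₀ := 0)
    (by rw [hV.init, ContinuousLinearMap.id_apply]) τ

lemma IsFundamentalSolution.isUnit [FiniteDimensional ℝ F] (hV : IsFundamentalSolution A V)
    (hA : Continuous A) (z : Cyl) : IsUnit (V z) := by
  have hinj : Function.Injective (V z) := by
    rw [injective_iff_map_eq_zero]
    intro u hu
    have h0 := (hV.isLinearSolution_apply u z.1).eq_zero hA (τ₀ := z.2) hu 0
    rwa [hV.init, ContinuousLinearMap.id_apply] at h0
  exact ContinuousLinearMap.isUnit_iff_bijective.2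
    ⟨hinj, LinearMap.surjective_of_injective (f := (V z).toLinearMap) hinj⟩

lemma IsFundamentalSolution.hasDerivWithinAt_inverse [CompleteSpace F]
    (hV : IsFundamentalSolution A V) (hunit : ∀ z, IsUnit (V z)) (φ : Circ) (τ : unitInterval) :
    HasDerivWithinAt (slice (fun z => Ring.inverse (V z)) φ)
      (-(Ring.inverse (V (φ, τ)) * A (φ, τ))) (Icc 0 1) (τ : ℝ) := by
  obtain ⟨U, hU⟩ := hunit (φ, τ)
  have hinverse := hasFDerivAt_ringInverse (𝕜 := ℝ) U
  rw [hU, ← slice_coe V φ τ] at hinverse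
  refine (hinverse.comp_hasDerivWithinAt (τ : ℝ) (hV.ode φ τ)).congr_deriv ?_
  have hcancel : V (φ, τ) * ↑U⁻¹ = 1 := by rw [← hU, Units.mul_inv]
  rw [← hU, Ring.inverse_unit, hU]
  change -(↑U⁻¹ * (A (φ, τ) * V (φ, τ)) * ↑U⁻¹) = -(↑U⁻¹ * A (φ, τ))
  rw [mul_assoc, mul_assoc, hcancel, mul_one]

end FundamentalSolution

section AdjointTransport

variable {E : Type*} [NormedAddCommGroup E] [InnerProductSpace ℝ E] [FiniteDimensional ℝ E]
  {A V : Cyl → E →L[ℝ] E}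

/-- A covector transported by `V` is the image of its initial value under the adjoint of `V⁻¹`. -/
lemma IsFundamentalSolution.hasDerivWithinAt_of_transport (hV : IsFundamentalSolution A V)
    (hA : Continuous A) {q : Cyl → E} {φ : Circ}
    (hq : ∀ (τ : unitInterval) (u : E), ⟪q (φ, τ), V (φ, τ) u⟫ = ⟪q (φ, 0), u⟫)
    (τ : unitInterval) :
    HasDerivWithinAt (slice q φ) (-(ContinuousLinearMap.adjoint (A (φ, τ)) (q (φ, τ))))
      (Icc 0 1) (τ : ℝ) := by
  have hq_eq : ∀ τ : unitInterval, q (φ, τ) = star (Ring.inverse (V (φ, τ))) (q (φ, 0)) := by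
    refine fun τ => ext_inner_right ℝ fun u => ?_
    have hcancel : V (φ, τ) (Ring.inverse (V (φ, τ)) u) = u :=
      DFunLike.congr_fun (Ring.mul_inverse_cancel _ (hV.isUnit hA (φ, τ))) u
    rw [ContinuousLinearMap.star_eq_adjoint, ContinuousLinearMap.adjoint_inner_left, ← hq τ,
      hcancel]
  have hderiv := (hV.hasDerivWithinAt_inverse (hV.isUnit hA) φ τ).star.clm_apply
    (hasDerivWithinAt_const (τ : ℝ) (Icc (0 : ℝ) 1) (q (φ, 0)))
  refine (hderiv.congr_deriv ?_).congr_of_mem (fun t _ => hq_eq _) τ.2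
  rw [map_zero, add_zero, star_neg, star_mul, neg_apply, mul_apply_eq_comp, ← hq_eq,
    ContinuousLinearMap.star_eq_adjoint]

end AdjointTransport

lemma IsVariational.isFundamentalSolution {n m : ℕ} {f : Vec n → Vec m → Vec n} {p : Vec m}
    {T : ℝ} {v : C(Cyl, Vec n)} {V : Cyl → Vec n →L[ℝ] Vec n} (hV : IsVariational f p T v V) :
    IsFundamentalSolution (jacobian f p T v) V where
  init := hV.init
  ode := hV.ode

section AdjointField

variable {E : Type*} [NormedAddCommGroup E] [InnerProductSpace ℝ E] [CompleteSpace E]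
  {A : Cyl → E →L[ℝ] E} {κ lam w : Cyl → E} {ρ : ℝ} {φ : Circ}

/-- `lam` solves the adjoint equation `∂_τ lam = -Aᵀ lam + κ` with source `κ`, compatibly with the
gluing `(φ,1) ∼ (φ+ρ,0)`. Continuity in `φ` is only required on the circle `τ = 0`. -/
structure IsAdjointField (A : Cyl → E →L[ℝ] E) (ρ : ℝ) (κ lam : Cyl → E) : Prop where
  continuous_initial : Continuous fun φ : Circ => lam (φ, 0)
  ode : ∀ (φ : Circ) (τ : unitInterval), HasDerivWithinAt (slice lam φ)
    (-(ContinuousLinearMap.adjoint (A (φ, τ)) (lam (φ, τ))) + κ (φ, τ)) (Icc 0 1) (τ : ℝ)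
  shift : ∀ φ : Circ, lam (φ, 1) = lam (φ + (ρ : Circ), 0)

lemma IsAdjointField.hasDerivWithinAt_inner (h : IsAdjointField A ρ κ lam)
    (hw : IsLinearSolution A w φ) (τ : unitInterval) :
    HasDerivWithinAt (slice (fun z => ⟪lam z, w z⟫) φ) ⟪κ (φ, τ), w (φ, τ)⟫ (Icc 0 1) (τ : ℝ) := by
  refine ((h.ode φ τ).inner ℝ (hw τ)).congr_deriv ?_
  rw [slice_coe, slice_coe, inner_add_left, inner_neg_left,
    ContinuousLinearMap.adjoint_inner_left]
  ring

lemma IsAdjointField.cylInt_inner_eq_zero (h : IsAdjointField A ρ κ lam) (hκ : Continuous κ)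
    (hw : IsInvariantField A ρ w) : cylInt (fun z => ⟪κ z, w z⟫) = 0 := by
  have hpair : Continuous fun φ : Circ => ⟪lam (φ, 0), w (φ, 0)⟫ :=
    h.continuous_initial.inner (hw.continuous.comp (Continuous.prodMk_left 0))
  have hslice : ∀ φ : Circ, ∫ s in (0 : ℝ)..1, slice (fun z => ⟪κ z, w z⟫) φ s =
      ⟪lam (φ + (ρ : Circ), 0), w (φ + (ρ : Circ), 0)⟫ - ⟪lam (φ, 0), w (φ, 0)⟫ := fun φ => by
    rw [← h.shift, ← hw.shift]
    exact (sub_eq_integral_slice (w := fun z => ⟪lam z, w z⟫) (g := fun z => ⟪κ z, w z⟫)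
      (h.hasDerivWithinAt_inner (hw.ode φ))
      (continuous_slice (hκ.inner hw.continuous) φ) 1).symm
  have hshifted : Continuous fun φ : Circ =>
      ⟪lam (φ + (ρ : Circ), 0), w (φ + (ρ : Circ), 0)⟫ :=
    hpair.comp (continuous_add_const (ρ : Circ))
  simp only [cylInt, hslice]
  rw [integral_sub (integrable_circ hshifted) (integrable_circ hpair),
    integral_add_right_eq_self (fun φ => ⟪lam (φ, 0), w (φ, 0)⟫),
    sub_self]

lemma IsAdjointField.inner_eq_inner_zero (h : IsAdjointField A ρ 0 lam)
    (hw : IsLinearSolution A w φ) (τ : unitInterval) :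
    ⟪lam (φ, τ), w (φ, τ)⟫ = ⟪lam (φ, 0), w (φ, 0)⟫ := by
  have hderiv : ∀ τ : unitInterval,
      HasDerivWithinAt (slice (fun z => ⟪lam z, w z⟫) φ) 0 (Icc 0 1) (τ : ℝ) := fun τ => by
    simpa only [Pi.zero_apply, inner_zero_left] using h.hasDerivWithinAt_inner hw τ
  have hsub := sub_eq_integral_slice (g := fun _ => (0 : ℝ)) hderiv continuous_const τ
  simpa only [slice, intervalIntegral.integral_zero, sub_eq_zero] using hsub

lemma IsAdjointField.inner_eq_inner (h : IsAdjointField A ρ 0 lam)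
    (hw : IsInvariantField A ρ w) (hρ : Irrational ρ) (z z' : Cyl) :
    ⟪lam z, w z⟫ = ⟪lam z', w z'⟫ := by
  have hperiodic : Function.Periodic (fun φ : Circ => ⟪lam (φ, 0), w (φ, 0)⟫) (ρ : Circ) :=
    fun φ => by
      simp only [← h.shift, ← hw.shift]
      exact h.inner_eq_inner_zero (hw.ode φ) 1
  have hzero := eq_of_periodic_of_denseRange (denseRange_zsmul_coe hρ)
    (h.continuous_initial.inner (hw.continuous.comp (Continuous.prodMk_left 0))) hperiodic z.1 z'.1
  rw [h.inner_eq_inner_zero (hw.ode z.1) z.2, h.inner_eq_inner_zero (hw.ode z'.1) z'.2]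
  exact hzero

end AdjointField

section Annihilation

variable {n : ℕ} {A V : Cyl → Vec n →L[ℝ] Vec n} {lam : Cyl → Vec n} {ρ : ℝ}

lemma IsAdjointField.integral_inner_Gam_eq_zero (h : IsAdjointField A ρ 0 lam)
    (hV : IsFundamentalSolution A V) {δ : Circ → Vec n} (hδ : Continuous δ) :
    ∫ φ : Circ, ⟪lam (φ, 0), Gam V ρ δ φ⟫ = 0 := by
  have hpair : Continuous fun φ : Circ => ⟪lam (φ, 0), δ φ⟫ := h.continuous_initial.inner hδ
  have hdiff : ∀ φ : Circ, ⟪lam (φ, 0), Gam V ρ δ φ⟫ =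
      ⟪lam (φ - (ρ : Circ), 0), δ (φ - (ρ : Circ))⟫ - ⟪lam (φ, 0), δ φ⟫ := fun φ => by
    have htransport := h.inner_eq_inner_zero
      (hV.isLinearSolution_apply (δ (φ - (ρ : Circ))) (φ - (ρ : Circ))) 1
    rw [h.shift, sub_add_cancel, hV.init, ContinuousLinearMap.id_apply] at htransport
    rw [Gam, inner_sub_right, htransport]
  have hshifted : Continuous fun φ : Circ =>
      ⟪lam (φ - (ρ : Circ), 0), δ (φ - (ρ : Circ))⟫ :=
    hpair.comp (continuous_id.sub continuous_const)
  simp only [hdiff]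
  rw [integral_sub (integrable_circ hshifted) (integrable_circ hpair),
    integral_sub_right_eq_self (fun φ => ⟪lam (φ, 0), δ φ⟫), sub_self]

lemma IsAdjointField.inner_apply_eq_zero (h : IsAdjointField A ρ 0 lam)
    (hV : IsFundamentalSolution A V) {P : Circ → Vec n →L[ℝ] Vec n} (hP : Continuous P)
    (hsurj : ∀ δ : Circ → Vec n, Continuous δ →
      ∃ γ : Circ → Vec n, Continuous γ ∧ Gam V ρ γ = fun φ => P φ (δ φ))
    (φ : Circ) (u : Vec n) : ⟪lam (φ, 0), P φ u⟫ = 0 := by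
  let δ : Circ → Vec n := fun φ => ContinuousLinearMap.adjoint (P φ) (lam (φ, 0))
  have hδ : Continuous δ :=
    (ContinuousLinearMap.adjoint.continuous.comp hP).clm_apply h.continuous_initial
  obtain ⟨γ, hγ, hγδ⟩ := hsurj δ hδ
  have hnorm : ∀ φ, ⟪lam (φ, 0), Gam V ρ γ φ⟫ = ‖δ φ‖ ^ 2 := fun φ => by
    rw [hγδ, ← ContinuousLinearMap.adjoint_inner_left, real_inner_self_eq_norm_sq]
  have hcont : Continuous fun φ => ‖δ φ‖ ^ 2 := hδ.norm.pow 2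
  have hint := h.integral_inner_Gam_eq_zero hV hγ
  simp only [hnorm] at hint
  rw [integral_eq_zero_iff_of_nonneg (fun φ => sq_nonneg _) (integrable_circ hcont),
    hcont.ae_eq_iff_eq _ continuous_zero] at hint
  have hzero : δ φ = 0 := norm_eq_zero.1 (pow_eq_zero_iff two_ne_zero |>.1 (congrFun hint φ))
  rw [← ContinuousLinearMap.adjoint_inner_left]
  exact (congrArg (⟪·, u⟫) hzero).trans (inner_zero_left u)

lemma IsAdjointField.eq_of_initial_eq {lam₁ lam₂ : Cyl → Vec n} (h₁ : IsAdjointField A ρ 0 lam₁)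
    (h₂ : IsAdjointField A ρ 0 lam₂) (hV : IsFundamentalSolution A V) (hA : Continuous A)
    {φ : Circ} (h0 : lam₁ (φ, 0) = lam₂ (φ, 0)) (τ : unitInterval) :
    lam₁ (φ, τ) = lam₂ (φ, τ) := by
  refine ext_inner_right ℝ fun x => ?_
  obtain ⟨u, rfl⟩ := (ContinuousLinearMap.isUnit_iff_bijective.1 (hV.isUnit hA (φ, τ))).2 x
  have hu := hV.isLinearSolution_apply u φ
  rw [h₁.inner_eq_inner_zero hu, h₂.inner_eq_inner_zero hu, h0]

end Annihilation

section DualVector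

variable {E : Type*} [NormedAddCommGroup E] [InnerProductSpace ℝ E]

/-- The vector of `span {a, b}` that pairs to `1` with `a` and to `0` with `b`, for linearly
independent `a` and `b`; otherwise the Gram determinant vanishes and the value is `0`. -/
def dualVector (a b : E) : E :=
  (⟪a, a⟫ * ⟪b, b⟫ - ⟪a, b⟫ ^ 2)⁻¹ • (⟪b, b⟫ • a - ⟪a, b⟫ • b)

lemma inner_mul_inner_sub_sq_ne_zero {a b : E} (h : LinearIndependent ℝ ![a, b]) :
    ⟪a, a⟫ * ⟪b, b⟫ - ⟪a, b⟫ ^ 2 ≠ 0 := by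
  have hdet := (Matrix.posDef_gram_iff_linearIndependent (𝕜 := ℝ).2 h).det_pos
  simp only [Matrix.det_fin_two, Matrix.gram_apply, Matrix.cons_val_zero, Matrix.cons_val_one,
    real_inner_comm a b] at hdet
  rw [sq]
  exact hdet.ne'

lemma inner_dualVector_left {a b : E} (h : LinearIndependent ℝ ![a, b]) :
    ⟪dualVector a b, a⟫ = 1 := by
  rw [dualVector, real_inner_smul_left, inner_sub_left, real_inner_smul_left,
    real_inner_smul_left, real_inner_comm a b, ← sq, mul_comm ⟪b, b⟫]
  exact inv_mul_cancel₀ (inner_mul_inner_sub_sq_ne_zero h)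

lemma inner_dualVector_right (a b : E) : ⟪dualVector a b, b⟫ = 0 := by
  rw [dualVector, real_inner_smul_left, inner_sub_left, real_inner_smul_left,
    real_inner_smul_left]
  ring

lemma continuous_dualVector {X : Type*} [TopologicalSpace X] {a b : X → E} (ha : Continuous a)
    (hb : Continuous b) (h : ∀ x, LinearIndependent ℝ ![a x, b x]) :
    Continuous fun x => dualVector (a x) (b x) := by
  have hdet : Continuous fun x => (⟪a x, a x⟫ * ⟪b x, b x⟫ - ⟪a x, b x⟫ ^ 2)⁻¹ :=
    Continuous.inv₀ (by fun_prop) fun x => inner_mul_inner_sub_sq_ne_zero (h x)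
  exact hdet.smul (by fun_prop)

lemma exists_pos_mul_abs_le_norm_add {X : Type*} [TopologicalSpace X] [CompactSpace X]
    {a b : X → E} (ha : Continuous a) (hb : Continuous b)
    (h : ∀ x, LinearIndependent ℝ ![a x, b x]) :
    ∃ r > 0, ∀ (x : X) (c d : ℝ), r * |d| ≤ ‖c • a x + d • b x‖ := by
  have hswap : ∀ x, LinearIndependent ℝ ![b x, a x] := fun x =>
    LinearIndependent.pair_symm_iff.1 (h x)
  obtain ⟨K, hK⟩ := isCompact_univ.exists_bound_of_continuousOn
    (continuous_dualVector hb ha hswap).continuousOn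
  have hKpos : 0 < |K| + 1 := by positivity
  refine ⟨(|K| + 1)⁻¹, inv_pos.2 hKpos, fun x c d => ?_⟩
  rw [inv_mul_le_iff₀ hKpos]
  have hd : ⟪dualVector (b x) (a x), c • a x + d • b x⟫ = d := by
    rw [inner_add_right, real_inner_smul_right, real_inner_smul_right, inner_dualVector_right,
      inner_dualVector_left (hswap x), mul_zero, zero_add, mul_one]
  calc |d| = |⟪dualVector (b x) (a x), c • a x + d • b x⟫| := by rw [hd]
    _ ≤ ‖dualVector (b x) (a x)‖ * ‖c • a x + d • b x‖ := abs_real_inner_le_norm _ _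
    _ ≤ (|K| + 1) * ‖c • a x + d • b x‖ := by
      gcongr
      linarith [hK x (mem_univ x), le_abs_self K]

end DualVector

section PhaseConditions

variable {n : ℕ} {k : Fin 2 → C(Cyl, Vec n)} {v : C(Cyl, Vec n)}

lemma phaseMatrix_mulVec (hτ : Continuous (dTau v)) (hφ : Continuous (dPhi v))
    (c : Fin 2 → ℝ) : phaseMatrix k v *ᵥ c =
      fun i => cylInt fun z => ⟪k i z, (c 0 • dTau v + c 1 • dPhi v) z⟫ := by
  funext i
  simp only [phaseMatrix, Matrix.mulVec, dotProduct, Fin.sum_univ_two, Matrix.of_apply,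
    Matrix.cons_val_zero, Matrix.cons_val_one, Pi.add_apply, Pi.smul_apply, inner_add_right,
    real_inner_smul_right]
  rw [cylInt_add (by fun_prop) (by fun_prop), cylInt_const_mul, cylInt_const_mul]
  ring

lemma vecMul_phaseMatrix (hτ : Continuous (dTau v)) (hφ : Continuous (dPhi v))
    (c : Fin 2 → ℝ) : c ᵥ* phaseMatrix k v =
      ![cylInt fun z => ⟪∑ i, c i • k i z, dTau v z⟫,
        cylInt fun z => ⟪∑ i, c i • k i z, dPhi v z⟫] := by
  funext j
  fin_cases j <;>
  · simp only [phaseMatrix, Matrix.vecMul, dotProduct, Fin.sum_univ_two, Matrix.of_apply,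
      Fin.zero_eta, Fin.mk_one, Matrix.cons_val_zero, Matrix.cons_val_one, inner_add_left,
      real_inner_smul_left]
    rw [cylInt_add (by fun_prop) (by fun_prop), cylInt_const_mul, cylInt_const_mul]

lemma linearIndependent_of_det_phaseMatrix_ne_zero {A : Cyl → Vec n →L[ℝ] Vec n} {ρ : ℝ}
    (hA : Continuous A) (hρ : Irrational ρ) (hτ : IsInvariantField A ρ (dTau v))
    (hφ : IsInvariantField A ρ (dPhi v)) (hdet : (phaseMatrix k v).det ≠ 0) (z : Cyl) :
    LinearIndependent ℝ ![dTau v z, dPhi v z] := by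
  refine LinearIndependent.pair_iff.2 fun c d hcd => ?_
  have hzero : c • dTau v + d • dPhi v = 0 :=
    ((hτ.const_smul c).add (hφ.const_smul d)).eq_zero hA hρ hcd
  have hker : phaseMatrix k v *ᵥ ![c, d] = 0 := by
    rw [phaseMatrix_mulVec hτ.continuous hφ.continuous]
    simp only [Matrix.cons_val_zero, Matrix.cons_val_one, hzero, Pi.zero_apply, inner_zero_right,
      cylInt_const]
    rfl
  have hcoef := Matrix.eq_zero_of_mulVec_eq_zero hdet hker
  exact ⟨congrFun hcoef 0, congrFun hcoef 1⟩

end PhaseConditions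

section TangentProjection

variable {n : ℕ} {ρ : ℝ} {v : C(Cyl, Vec n)} {A V : Cyl → Vec n →L[ℝ] Vec n}
  {qτ qφ : Cyl → Vec n}

lemma qtg_apply (v : C(Cyl, Vec n)) (qτ qφ : Cyl → Vec n) (z : Cyl) (u : Vec n) :
    qtg v qτ qφ z u = ⟪qτ z, u⟫ • dTau v z + ⟪qφ z, u⟫ • dPhi v z :=
  rfl

lemma adjoint_qtg_apply (v : C(Cyl, Vec n)) (qτ qφ : Cyl → Vec n) (z : Cyl) (y : Vec n) :
    ContinuousLinearMap.adjoint (qtg v qτ qφ z) y =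
      ⟪y, dTau v z⟫ • qτ z + ⟪y, dPhi v z⟫ • qφ z := by
  refine ext_inner_right ℝ fun u => ?_
  rw [ContinuousLinearMap.adjoint_inner_left, qtg_apply]
  simp only [inner_add_left, inner_add_right, real_inner_smul_left, real_inner_smul_right]
  ring

lemma IsNormallyHyperbolic.qtg_apply_of_mem (hnh : IsNormallyHyperbolic ρ v V qτ qφ) {z : Cyl}
    {u : Vec n} (hu : u ∈ Submodule.span ℝ {dTau v z, dPhi v z}) : qtg v qτ qφ z u = u := by
  rw [← hnh.range_eq z] at hu
  obtain ⟨y, rfl⟩ := hu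
  exact DFunLike.congr_fun (hnh.idem z) y

lemma IsNormallyHyperbolic.inner_dTau (hnh : IsNormallyHyperbolic ρ v V qτ qφ) {z : Cyl}
    (hli : LinearIndependent ℝ ![dTau v z, dPhi v z]) :
    ⟪qτ z, dTau v z⟫ = 1 ∧ ⟪qφ z, dTau v z⟫ = 0 := by
  have hfix := hnh.qtg_apply_of_mem (z := z) (Submodule.subset_span (mem_insert _ _))
  rw [qtg_apply] at hfix
  exact hli.eq_of_pair (by rw [hfix, one_smul, zero_smul, add_zero])

lemma IsNormallyHyperbolic.inner_dPhi (hnh : IsNormallyHyperbolic ρ v V qτ qφ) {z : Cyl}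
    (hli : LinearIndependent ℝ ![dTau v z, dPhi v z]) :
    ⟪qτ z, dPhi v z⟫ = 0 ∧ ⟪qφ z, dPhi v z⟫ = 1 := by
  have hfix := hnh.qtg_apply_of_mem (z := z)
    (Submodule.subset_span (mem_insert_of_mem _ (mem_singleton _)))
  rw [qtg_apply] at hfix
  exact hli.eq_of_pair (by rw [hfix, one_smul, zero_smul, zero_add])

lemma IsNormallyHyperbolic.q_one (hnh : IsNormallyHyperbolic ρ v V qτ qφ)
    (hli : ∀ z, LinearIndependent ℝ ![dTau v z, dPhi v z])
    (hτ : IsInvariantField A ρ (dTau v)) (hφ : IsInvariantField A ρ (dPhi v)) (φ : Circ) :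
    qτ (φ, 1) = qτ (φ + (ρ : Circ), 0) ∧ qφ (φ, 1) = qφ (φ + (ρ : Circ), 0) := by
  have hpair : ∀ u, ⟪qτ (φ, 1), u⟫ = ⟪qτ (φ + (ρ : Circ), 0), u⟫ ∧
      ⟪qφ (φ, 1), u⟫ = ⟪qφ (φ + (ρ : Circ), 0), u⟫ := fun u => by
    have hshift := DFunLike.congr_fun (hnh.shift φ) u
    simp only [qtg_apply, ← hτ.shift, ← hφ.shift] at hshift
    exact (hli _).eq_of_pair hshift
  exact ⟨ext_inner_right ℝ fun u => (hpair u).1, ext_inner_right ℝ fun u => (hpair u).2⟩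

lemma IsNormallyHyperbolic.inner_q_apply (hnh : IsNormallyHyperbolic ρ v V qτ qφ)
    (hli : ∀ z, LinearIndependent ℝ ![dTau v z, dPhi v z]) (hA : Continuous A)
    (hV : IsFundamentalSolution A V) (hτ : IsInvariantField A ρ (dTau v))
    (hφ : IsInvariantField A ρ (dPhi v)) (φ : Circ) (τ : unitInterval) (u : Vec n) :
    ⟪qτ (φ, τ), V (φ, τ) u⟫ = ⟪qτ (φ, 0), u⟫ ∧ ⟪qφ (φ, τ), V (φ, τ) u⟫ = ⟪qφ (φ, 0), u⟫ := by
  have hcomm := DFunLike.congr_fun (hnh.invariant φ τ) u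
  simp only [ContinuousLinearMap.comp_apply, qtg_apply, map_add, map_smul,
    hV.apply_eq hA (hτ.ode φ), hV.apply_eq hA (hφ.ode φ)] at hcomm
  exact (hli _).eq_of_pair hcomm

lemma IsNormallyHyperbolic.continuous_q (hnh : IsNormallyHyperbolic ρ v V qτ qφ)
    (hli : ∀ z, LinearIndependent ℝ ![dTau v z, dPhi v z]) (hτ : Continuous (dTau v))
    (hφ : Continuous (dPhi v)) : Continuous qτ ∧ Continuous qφ := by
  have hadjoint : Continuous fun z => ContinuousLinearMap.adjoint (qtg v qτ qφ z) :=
    ContinuousLinearMap.adjoint.continuous.comp hnh.cont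
  have hli' : ∀ z, LinearIndependent ℝ ![dPhi v z, dTau v z] := fun z =>
    LinearIndependent.pair_symm_iff.1 (hli z)
  constructor
  · refine (hadjoint.clm_apply (continuous_dualVector hτ hφ hli)).congr fun z => ?_
    rw [adjoint_qtg_apply, inner_dualVector_left (hli z), inner_dualVector_right, one_smul,
      zero_smul, add_zero]
  · refine (hadjoint.clm_apply (continuous_dualVector hφ hτ hli')).congr fun z => ?_
    rw [adjoint_qtg_apply, inner_dualVector_left (hli' z), inner_dualVector_right, one_smul,
      zero_smul, zero_add]

lemma IsNormallyHyperbolic.isAdjointField (hnh : IsNormallyHyperbolic ρ v V qτ qφ)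
    (hli : ∀ z, LinearIndependent ℝ ![dTau v z, dPhi v z]) (hA : Continuous A)
    (hV : IsFundamentalSolution A V) (hτ : IsInvariantField A ρ (dTau v))
    (hφ : IsInvariantField A ρ (dPhi v)) (a b : ℝ) :
    IsAdjointField A ρ 0 fun z => a • qτ z - b • qφ z where
  continuous_initial := by
    obtain ⟨hqτ, hqφ⟩ := hnh.continuous_q hli hτ.continuous hφ.continuous
    fun_prop
  ode φ τ := by
    rw [Pi.zero_apply, add_zero]
    refine hV.hasDerivWithinAt_of_transport hA (q := fun z => a • qτ z - b • qφ z)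
      (fun τ u => ?_) τ
    obtain ⟨hqτ, hqφ⟩ := hnh.inner_q_apply hli hA hV hτ hφ φ τ u
    simp only [inner_sub_left, real_inner_smul_left, hqτ, hqφ]
  shift φ := by
    obtain ⟨hqτ, hqφ⟩ := hnh.q_one hli hτ hφ φ
    simp only [hqτ, hqφ]

lemma IsNormallyHyperbolic.continuous_qtr (hnh : IsNormallyHyperbolic ρ v V qτ qφ) :
    Continuous (qtr v qτ qφ) :=
  continuous_const.sub hnh.cont

lemma IsNormallyHyperbolic.exists_Gam_eq (hnh : IsNormallyHyperbolic ρ v V qτ qφ)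
    {δ : Circ → Vec n} (hδ : Continuous δ) :
    ∃ γ : Circ → Vec n, Continuous γ ∧ Gam V ρ γ = fun φ => qtr v qτ qφ (φ, 0) (δ φ) := by
  obtain ⟨_, ⟨δ', hδ', rfl⟩, hγ⟩ := hnh.bijOn.surjOn ⟨δ, hδ, rfl⟩
  exact ⟨_, (hnh.continuous_qtr.comp (Continuous.prodMk_left 0)).clm_apply hδ', hγ⟩

/-- An adjoint field annihilates the range of `qtr`, so it is determined by its pairings with the
two tangent fields. -/
lemma IsNormallyHyperbolic.adjointField_eq (hnh : IsNormallyHyperbolic ρ v V qτ qφ)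
    (hli : ∀ z, LinearIndependent ℝ ![dTau v z, dPhi v z]) (hA : Continuous A)
    (hV : IsFundamentalSolution A V) (hτ : IsInvariantField A ρ (dTau v))
    (hφ : IsInvariantField A ρ (dPhi v)) {lam : Cyl → Vec n} (hlam : IsAdjointField A ρ 0 lam)
    {a b : ℝ} (ha : ∀ z, ⟪lam z, dTau v z⟫ = a) (hb : ∀ z, ⟪lam z, dPhi v z⟫ = -b) (z : Cyl) :
    lam z = a • qτ z - b • qφ z := by
  have hinitial : ∀ φ : Circ, lam (φ, 0) = a • qτ (φ, 0) - b • qφ (φ, 0) := fun φ => by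
    refine ext_inner_right ℝ fun u => ?_
    have htr := hlam.inner_apply_eq_zero hV
      (hnh.continuous_qtr.comp (Continuous.prodMk_left 0)) (fun δ => hnh.exists_Gam_eq) φ u
    have htg : ⟪lam (φ, 0), qtg v qτ qφ (φ, 0) u⟫ = a * ⟪qτ (φ, 0), u⟫ - b * ⟪qφ (φ, 0), u⟫ := by
      rw [qtg_apply, inner_add_right, real_inner_smul_right, real_inner_smul_right, ha, hb]
      ring
    rw [inner_sub_left, real_inner_smul_left, real_inner_smul_left, ← htg, ← sub_eq_zero,
      ← inner_sub_right]
    exact htr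
  exact hlam.eq_of_initial_eq (hnh.isAdjointField hli hA hV hτ hφ a b) hV hA (hinitial z.1) z.2

end TangentProjection

section AdjointConditions

variable {n m : ℕ} {f : Vec n → Vec m → Vec n} {p : Vec m} {T ρ : ℝ} {v : C(Cyl, Vec n)}
  {V : Cyl → Vec n →L[ℝ] Vec n} {qτ qφ : Cyl → Vec n} {k : Fin 2 → C(Cyl, Vec n)}
  {kp : Fin 2 → Vec m →L[ℝ] ℝ} {ηT ηρ : ℝ} {X Y : AdjointVars n m}

lemma integral_circ_const (c : ℝ) : ∫ _ : Circ, c = c := by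
  simp [Measure.real, AddCircle.measure_univ]

lemma adjoint_jacobian_apply (f : Vec n → Vec m → Vec n) (p : Vec m) (T : ℝ) (v : C(Cyl, Vec n))
    (z : Cyl) (y : Vec n) : ContinuousLinearMap.adjoint (jacobian f p T v z) y =
      T • ContinuousLinearMap.adjoint (dfx f (v z) p) y := by
  rw [jacobian, map_smul, smul_apply]

namespace IsAdjointSolution

lemma bc_eq (hX : IsAdjointSolution f p T ρ v k kp ηT ηρ X) (φ : Circ) : X.bc φ = X.de (φ, 1) :=
  (sub_eq_zero.1 (hX.var_v1 φ).symm).symm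

lemma de_zero (hX : IsAdjointSolution f p T ρ v k kp ηT ηρ X) (φ : Circ) :
    X.de (φ, 0) = X.bc (φ - (ρ : Circ)) :=
  neg_add_eq_zero.1 (hX.var_v0 φ).symm

lemma isAdjointField (hX : IsAdjointSolution f p T ρ v k kp ηT ηρ X) (hbc : Continuous X.bc) :
    IsAdjointField (jacobian f p T v) ρ (fun z => ∑ i, X.ps i • k i z) X.de where
  continuous_initial := by
    simp only [hX.de_zero]
    exact hbc.comp (continuous_id.sub continuous_const)
  ode φ τ := by
    rw [adjoint_jacobian_apply]
    exact hX.var_v φ τ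
  shift φ := by rw [hX.de_zero, add_sub_cancel_right, hX.bc_eq]

lemma ps_eq_zero (hX : IsAdjointSolution f p T ρ v k kp ηT ηρ X) (hbc : Continuous X.bc)
    (hτ : IsInvariantField (jacobian f p T v) ρ (dTau v))
    (hφ : IsInvariantField (jacobian f p T v) ρ (dPhi v)) (hdet : (phaseMatrix k v).det ≠ 0) :
    X.ps = 0 := by
  have hκ : Continuous fun z => ∑ i, X.ps i • k i z := by fun_prop
  refine Matrix.eq_zero_of_vecMul_eq_zero hdet ?_
  rw [vecMul_phaseMatrix hτ.continuous hφ.continuous,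
    (hX.isAdjointField hbc).cylInt_inner_eq_zero hκ hτ,
    (hX.isAdjointField hbc).cylInt_inner_eq_zero hκ hφ]
  funext j
  fin_cases j <;> rfl

lemma isAdjointField_of_ps_eq_zero (hX : IsAdjointSolution f p T ρ v k kp ηT ηρ X)
    (hbc : Continuous X.bc) (hps : X.ps = 0) :
    IsAdjointField (jacobian f p T v) ρ 0 X.de := by
  convert hX.isAdjointField hbc using 1
  funext z
  simp only [hps, Pi.zero_apply, zero_smul, Finset.sum_const_zero]

lemma inner_dTau (hX : IsAdjointSolution f p T ρ v k kp ηT ηρ X) (hbc : Continuous X.bc)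
    (hps : X.ps = 0) (hρ : Irrational ρ) (hv : IsTorusSolution f p T ρ v)
    (hτ : IsInvariantField (jacobian f p T v) ρ (dTau v)) (z : Cyl) :
    ⟪X.de z, dTau v z⟫ = T * ηT :=
  calc ⟪X.de z, dTau v z⟫ = cylInt fun _ => ⟪X.de z, dTau v z⟫ := (cylInt_const _).symm
    _ = cylInt fun z' => T * ⟪X.de z', f (v z') p⟫ := congrArg cylInt (funext fun z' => by
      rw [(hX.isAdjointField_of_ps_eq_zero hbc hps).inner_eq_inner hτ hρ z z', hv.dTau_eq,
        real_inner_smul_right])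
    _ = T * ηT := by rw [cylInt_const_mul, neg_add_eq_zero.1 hX.var_T.symm]

lemma inner_dPhi (hX : IsAdjointSolution f p T ρ v k kp ηT ηρ X) (hbc : Continuous X.bc)
    (hps : X.ps = 0) (hρ : Irrational ρ)
    (hφ : IsInvariantField (jacobian f p T v) ρ (dPhi v)) (z : Cyl) :
    ⟪X.de z, dPhi v z⟫ = -ηρ :=
  calc ⟪X.de z, dPhi v z⟫ = ∫ _ : Circ, ⟪X.de z, dPhi v z⟫ := (integral_circ_const _).symm
    _ = ∫ φ : Circ, ⟪X.bc φ, dPhi v (φ + (ρ : Circ), 0)⟫ := by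
      congr 1 with φ
      rw [hX.bc_eq, ← hφ.shift,
        (hX.isAdjointField_of_ps_eq_zero hbc hps).inner_eq_inner hφ hρ z (φ, 1)]
    _ = -ηρ := eq_neg_of_add_eq_zero_left hX.var_ρ.symm

lemma eq_of_de_eq (hX : IsAdjointSolution f p T ρ v k kp ηT ηρ X)
    (hY : IsAdjointSolution f p T ρ v k kp ηT ηρ Y) (hde : X.de = Y.de) (hps : X.ps = Y.ps) :
    X = Y := by
  refine AdjointVars.ext hde (funext fun φ => ?_) hps (ext_inner_right ℝ fun δp => ?_)
  · rw [hX.bc_eq, hY.bc_eq, hde]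
  · have hXp := hX.var_p δp
    have hYp := hY.var_p δp
    rw [hde, hps] at hXp
    linarith

end IsAdjointSolution

lemma exists_inner_eq_cylInt {q : Cyl → Vec n} (hq : Continuous q)
    {B : Cyl → Vec m →L[ℝ] Vec n} (hB : Continuous B) :
    ∃ η : Vec m, ∀ δp, ⟪η, δp⟫ = cylInt fun z => ⟪q z, B z δp⟫ := by
  let L : Vec m →ₗ[ℝ] ℝ :=
    { toFun := fun δp => cylInt fun z => ⟪q z, B z δp⟫
      map_add' := fun x y => by
        simp only [map_add, inner_add_right]
        exact cylInt_add (by fun_prop) (by fun_prop)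
      map_smul' := fun c x => by
        simp only [map_smul, real_inner_smul_right]
        exact cylInt_const_mul c _ }
  exact ⟨(InnerProductSpace.toDual ℝ (Vec m)).symm (LinearMap.toContinuousLinearMap L),
    fun δp => InnerProductSpace.toDual_symm_apply⟩

lemma IsAdjointField.exists_isAdjointSolution {lam : Cyl → Vec n}
    (hlam : IsAdjointField (jacobian f p T v) ρ 0 lam) (hcont : Continuous lam)
    (hf : ContDiff ℝ 1 fun x : Vec n × Vec m => f x.1 x.2)
    (hηT : ∀ z, ⟪lam z, f (v z) p⟫ = ηT)
    (hηρ : ∀ φ : Circ, ⟪lam (φ, 1), dPhi v (φ + (ρ : Circ), 0)⟫ = -ηρ)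
    (k : Fin 2 → C(Cyl, Vec n)) (kp : Fin 2 → Vec m →L[ℝ] ℝ) :
    ∃ X : AdjointVars n m, IsAdjointSolution f p T ρ v k kp ηT ηρ X ∧ X.de = lam ∧
      Continuous X.bc ∧ X.ps = 0 := by
  have hB : Continuous fun z => T • dfp f (v z) p :=
    ((continuous_dfp hf p).comp v.continuous).const_smul T
  obtain ⟨ηp, hηp⟩ := exists_inner_eq_cylInt hcont hB
  refine ⟨⟨lam, fun φ => lam (φ, 1), 0, ηp⟩, ⟨fun φ τ => ?_, fun φ => ?_, fun φ => ?_, ?_, ?_,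
    fun δp => ?_⟩, rfl, hcont.comp (Continuous.prodMk_left 1), rfl⟩
  · rw [← adjoint_jacobian_apply]
    simpa only [Pi.zero_apply, zero_smul, Finset.sum_const_zero] using hlam.ode φ τ
  · rw [sub_self]
  · simp only [hlam.shift, sub_add_cancel, neg_add_cancel]
  · simp only [hηT, cylInt_const, neg_add_cancel]
  · simp only [hηρ, integral_circ_const, neg_add_cancel]
  · simp only [hηp, smul_apply, Pi.zero_apply, zero_mul, Finset.sum_const_zero, add_zero,
      neg_add_cancel]

lemma IsAdjointSolution.de_eq (hX : IsAdjointSolution f p T ρ v k kp ηT ηρ X)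
    (hbc : Continuous X.bc) (hps : X.ps = 0) (hρ : Irrational ρ) (hv : IsTorusSolution f p T ρ v)
    (hf : ContDiff ℝ 1 fun y => f y p) (hV : IsVariational f p T v V)
    (hnh : IsNormallyHyperbolic ρ v V qτ qφ)
    (hli : ∀ z, LinearIndependent ℝ ![dTau v z, dPhi v z]) (z : Cyl) :
    X.de z = (T * ηT) • qτ z - ηρ • qφ z :=
  have hτ := hv.isInvariantField_dTau hf
  have hφ := hv.isInvariantField_dPhi hf
  hnh.adjointField_eq hli (continuous_jacobian hf T v) hV.isFundamentalSolution hτ hφ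
    (hX.isAdjointField_of_ps_eq_zero hbc hps) (hX.inner_dTau hbc hps hρ hv hτ)
    (hX.inner_dPhi hbc hps hρ hφ) z

lemma IsTorusSolution.period_ne_zero (hv : IsTorusSolution f p T ρ v) {z : Cyl}
    (hz : dTau v z ≠ 0) : T ≠ 0 := by
  rintro rfl
  exact hz (by rw [hv.dTau_eq, zero_smul])

lemma IsNormallyHyperbolic.exists_isAdjointSolution (hnh : IsNormallyHyperbolic ρ v V qτ qφ)
    (hv : IsTorusSolution f p T ρ v) (hf : ContDiff ℝ 1 fun x : Vec n × Vec m => f x.1 x.2)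
    (hV : IsVariational f p T v V) (hli : ∀ z, LinearIndependent ℝ ![dTau v z, dPhi v z])
    (k : Fin 2 → C(Cyl, Vec n)) (kp : Fin 2 → Vec m →L[ℝ] ℝ) (ηT ηρ : ℝ) :
    ∃ X : AdjointVars n m, IsAdjointSolution f p T ρ v k kp ηT ηρ X ∧
      X.de = (fun z => (T * ηT) • qτ z - ηρ • qφ z) ∧ Continuous X.de ∧ Continuous X.bc ∧
      X.ps = 0 := by
  have hfx : ContDiff ℝ 1 fun y => f y p := hf.comp (contDiff_id.prodMk contDiff_const)
  have hτ := hv.isInvariantField_dTau hfx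
  have hφ := hv.isInvariantField_dPhi hfx
  obtain ⟨hqτ, hqφ⟩ := hnh.continuous_q hli hτ.continuous hφ.continuous
  have hcont : Continuous fun z => (T * ηT) • qτ z - ηρ • qφ z := by fun_prop
  have hηT : ∀ z, ⟪(T * ηT) • qτ z - ηρ • qφ z, f (v z) p⟫ = ηT := fun z => by
    refine mul_left_cancel₀ (hv.period_ne_zero ((hli z).ne_zero 0)) ?_
    rw [← real_inner_smul_right, ← hv.dTau_eq, inner_sub_left, real_inner_smul_left,
      real_inner_smul_left, (hnh.inner_dTau (hli z)).1, (hnh.inner_dTau (hli z)).2]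
    ring
  have hηρ : ∀ φ : Circ, ⟪(T * ηT) • qτ (φ, 1) - ηρ • qφ (φ, 1),
      dPhi v (φ + (ρ : Circ), 0)⟫ = -ηρ := fun φ => by
    rw [← hφ.shift, inner_sub_left, real_inner_smul_left, real_inner_smul_left,
      (hnh.inner_dPhi (hli _)).1, (hnh.inner_dPhi (hli _)).2]
    ring
  obtain ⟨X, hX, hde, hbc, hps⟩ := (hnh.isAdjointField hli (continuous_jacobian hfx T v)
    hV.isFundamentalSolution hτ hφ (T * ηT) ηρ).exists_isAdjointSolution hcont hf hηT hηρ k kp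
  exact ⟨X, hX, hde, hde ▸ hcont, hbc, hps⟩

end AdjointConditions

section SmallDefect

variable {n m : ℕ} {f : Vec n → Vec m → Vec n} {p : Vec m} {T ρ : ℝ} {v : C(Cyl, Vec n)}
  {k : Fin 2 → C(Cyl, Vec n)} {kp : Fin 2 → Vec m →L[ℝ] ℝ} {C : ℝ}

lemma LinearizationBound.norm_le (hbound : LinearizationBound f p T ρ v k kp C)
    (hf : ContDiff ℝ 1 fun y => f y p) {δ : C(Cyl, Vec n)}
    (hode : ∀ φ, IsLinearSolution (jacobian f p T v) δ φ) {ε : ℝ} (hε : 0 ≤ ε)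
    (hdefect : ∀ φ : Circ, ‖δ (φ + (ρ : Circ), 0) - δ (φ, 1)‖ ≤ ε)
    (hphase : ∀ i, cylInt (fun z => ⟪k i z, δ z⟫) = 0) (z : Cyl) : ‖δ z‖ ≤ C * ε := by
  have hdTau : ∀ z, dTau δ z = jacobian f p T v z (δ z) := fun z =>
    dTau_eq_of_hasDerivWithinAt (hode z.1 z.2)
  have hcont : Continuous (dTau δ) := by
    simp only [funext hdTau]
    exact (continuous_jacobian hf T v).clm_apply δ.continuous
  refine (hbound δ 0 0 0 ε ⟨fun z => (hode z.1 z.2).differentiableWithinAt, hcont⟩ (fun z => ?_)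
    (fun φ => ?_) (fun i => ?_) (by rwa [norm_zero])).1 z
  · have hzero : linOde f p T v δ 0 0 z = 0 := by
      simp only [linOde, hdTau, jacobian, smul_apply, sub_self, zero_smul, map_zero, smul_zero]
    rwa [hzero, norm_zero]
  · simpa only [linBc, zero_smul, add_zero] using hdefect φ
  · rwa [linPhase, hphase, map_zero, add_zero, abs_zero]

lemma exists_add_tangent_phase_eq_zero (hτ : Continuous (dTau v)) (hφ : Continuous (dPhi v))
    (hdet : (phaseMatrix k v).det ≠ 0) {w : Cyl → Vec n} (hw : Continuous w) :
    ∃ c : Fin 2 → ℝ, ∀ i,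
      cylInt (fun z => ⟪k i z, (w + (c 0 • dTau v + c 1 • dPhi v)) z⟫) = 0 := by
  obtain ⟨c, hc⟩ := (Matrix.mulVec_surjective_iff_isUnit.2
    ((Matrix.isUnit_iff_isUnit_det _).2 hdet.isUnit)) fun i => -cylInt fun z => ⟪k i z, w z⟫
  rw [phaseMatrix_mulVec hτ hφ] at hc
  refine ⟨c, fun i => ?_⟩
  have htangent : Continuous (c 0 • dTau v + c 1 • dPhi v) := by fun_prop
  simp only [Pi.add_apply w, inner_add_right]
  rw [cylInt_add (by fun_prop) ((k i).continuous.inner htangent), congrFun hc i, add_neg_cancel]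

lemma IsInvariantField.exists_modulation {A : Cyl → Vec n →L[ℝ] Vec n} {w : Cyl → Vec n}
    (hw : IsInvariantField A ρ w) {ε : ℝ} (hε : 0 < ε) :
    ∃ g : C(Circ, ℝ), (∀ φ : Circ,
      ‖g (φ + (ρ : Circ)) • w (φ + (ρ : Circ), 0) - g φ • w (φ, 1)‖ ≤ ε) ∧
      (∃ φ, g φ = 1) ∧ ∃ φ, g φ = -1 := by
  obtain ⟨B, hB⟩ := isCompact_univ.exists_bound_of_continuousOn hw.continuous.continuousOn
  have hBpos : 0 < |B| + 1 := by positivity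
  obtain ⟨g, hg, hvalues⟩ := exists_almost_invariant (ρ : Circ) (div_pos hε hBpos)
  refine ⟨g, fun φ => ?_, hvalues⟩
  rw [hw.shift, ← sub_smul, norm_smul, ← div_mul_cancel₀ ε hBpos.ne']
  gcongr
  · exact hg φ
  · linarith [hB (φ + (ρ : Circ), 0) (mem_univ _), le_abs_self B]

/-- Adding tangent fields to the modulated `∂_φ v` restores the phase conditions at no cost, since
the tangent fields have no gluing defect. -/
lemma exists_isLinearSolution_small_defect (hv : IsTorusSolution f p T ρ v)
    (hf : ContDiff ℝ 1 fun y => f y p) (hdet : (phaseMatrix k v).det ≠ 0) {ε : ℝ} (hε : 0 < ε) :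
    ∃ (δ : C(Cyl, Vec n)) (z : Cyl) (c d : ℝ), (∀ φ, IsLinearSolution (jacobian f p T v) δ φ) ∧
      (∀ φ : Circ, ‖δ (φ + (ρ : Circ), 0) - δ (φ, 1)‖ ≤ ε) ∧
      (∀ i, cylInt (fun z => ⟪k i z, δ z⟫) = 0) ∧
      δ z = c • dTau v z + d • dPhi v z ∧ 1 ≤ |d| := by
  have hτ := hv.isInvariantField_dTau hf
  have hφ := hv.isInvariantField_dPhi hf
  have hτc := hτ.continuous
  have hφc := hφ.continuous
  obtain ⟨g, hg, ⟨φ₁, h₁⟩, φ₂, h₂⟩ := hφ.exists_modulation hε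
  obtain ⟨c, hc⟩ := exists_add_tangent_phase_eq_zero hτc hφc hdet (w := fun z => g z.1 • dPhi v z)
    (by fun_prop)
  have htangent := (hτ.const_smul (c 0)).add (hφ.const_smul (c 1))
  let δ : C(Cyl, Vec n) :=
    ⟨(fun z => g z.1 • dPhi v z) + (c 0 • dTau v + c 1 • dPhi v), by fun_prop⟩
  have hδ : ∀ z, δ z = c 0 • dTau v z + (g z.1 + c 1) • dPhi v z := fun z => by
    change g z.1 • dPhi v z + (c 0 • dTau v z + c 1 • dPhi v z) = _
    rw [add_smul, add_left_comm]
  have hode : ∀ φ, IsLinearSolution (jacobian f p T v) δ φ := fun φ =>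
    IsLinearSolution.add ((hφ.ode φ).const_smul (g φ)) (htangent.ode φ)
  have hdefect : ∀ φ : Circ, ‖δ (φ + (ρ : Circ), 0) - δ (φ, 1)‖ ≤ ε := fun φ => by
    have hdiff : δ (φ + (ρ : Circ), 0) - δ (φ, 1) =
        g (φ + (ρ : Circ)) • dPhi v (φ + (ρ : Circ), 0) - g φ • dPhi v (φ, 1) := by
      rw [hδ, hδ, hτ.shift, hφ.shift]
      module
    exact hdiff ▸ hg φ
  rcases le_total 0 (c 1) with hc1 | hc1
  · refine ⟨δ, (φ₁, 0), c 0, g φ₁ + c 1, hode, hdefect, hc, hδ _, ?_⟩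
    rw [h₁]
    exact (le_add_of_nonneg_right hc1).trans (le_abs_self _)
  · refine ⟨δ, (φ₂, 0), c 0, g φ₂ + c 1, hode, hdefect, hc, hδ _, ?_⟩
    rw [h₂]
    linarith [neg_le_abs (-1 + c 1)]

lemma not_linearizationBound (hv : IsTorusSolution f p T ρ v) (hf : ContDiff ℝ 1 fun y => f y p)
    (hli : ∀ z, LinearIndependent ℝ ![dTau v z, dPhi v z]) (hdet : (phaseMatrix k v).det ≠ 0) :
    ¬ ∃ C, LinearizationBound f p T ρ v k kp C := by
  rintro ⟨C, hC⟩
  obtain ⟨r, hr, hlower⟩ := exists_pos_mul_abs_le_norm_add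
    (hv.isInvariantField_dTau hf).continuous (hv.isInvariantField_dPhi hf).continuous hli
  have hpos : 0 < |C| + 1 := by positivity
  obtain ⟨δ, z, c, d, hode, hdefect, hphase, hδ, hd⟩ :=
    exists_isLinearSolution_small_defect hv hf hdet (div_pos hr hpos)
  have hupper := hC.norm_le hf hode (div_pos hr hpos).le hdefect hphase z
  rw [hδ] at hupper
  have hlt : r < r :=
    calc r ≤ r * |d| := le_mul_of_one_le_right hr.le hd
      _ ≤ C * (r / (|C| + 1)) := (hlower z c d).trans hupper
      _ < (|C| + 1) * (r / (|C| + 1)) := by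
        gcongr
        exact (le_abs_self C).trans_lt (lt_add_one _)
      _ = r := mul_div_cancel₀ r hpos.ne'
  exact hlt.false

end SmallDefect

end QPTorus

end

theorem mainTheorem1 {n m : ℕ}
    (f : QPTorus.Vec n → QPTorus.Vec m → QPTorus.Vec n)
    (hf : ContDiff ℝ 1 (fun x : QPTorus.Vec n × QPTorus.Vec m => f x.1 x.2))
    (p : QPTorus.Vec m) (T ρ : ℝ) (hρ : Irrational ρ)
    (v : C(QPTorus.Cyl, QPTorus.Vec n))
    (hv : QPTorus.IsTorusSolution f p T ρ v)
    (h : Fin 2 → C(QPTorus.Cyl, QPTorus.Vec n) → QPTorus.Vec m → ℝ)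
    (hphase : ∀ i, h i v p = 0)
    (k : Fin 2 → C(QPTorus.Cyl, QPTorus.Vec n))
    (kp : Fin 2 → QPTorus.Vec m →L[ℝ] ℝ)
    (hk : QPTorus.IsPhaseDeriv h v p k kp)
    (hnondeg : (QPTorus.phaseMatrix k v).det ≠ 0)
    (V : QPTorus.Cyl → QPTorus.Vec n →L[ℝ] QPTorus.Vec n)
    (hV : QPTorus.IsVariational f p T v V)
    (qτ qφ : QPTorus.Cyl → QPTorus.Vec n)
    (hnh : QPTorus.IsNormallyHyperbolic ρ v V qτ qφ) :
    -- every solution of the adjoint conditions that is continuous in `φ`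
    (∀ (ηT ηρ : ℝ) (X : QPTorus.AdjointVars n m),
      QPTorus.IsAdjointSolution f p T ρ v k kp ηT ηρ X → Continuous X.bc →
        X.ps = 0 ∧ ∀ z, X.de z = (T * ηT) • qτ z - ηρ • qφ z) ∧
    -- existence and uniqueness for `(η_T, η_ρ) = (1, 0)`
    (∃ X : QPTorus.AdjointVars n m,
      QPTorus.IsAdjointSolution f p T ρ v k kp 1 0 X ∧ Continuous X.de ∧ Continuous X.bc ∧
        (∀ z, X.de z = T • qτ z) ∧
        ∀ Y, QPTorus.IsAdjointSolution f p T ρ v k kp 1 0 Y → Continuous Y.bc → Y = X) ∧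
    -- existence and uniqueness for `(η_T, η_ρ) = (0, 1)`
    (∃ X : QPTorus.AdjointVars n m,
      QPTorus.IsAdjointSolution f p T ρ v k kp 0 1 X ∧ Continuous X.de ∧ Continuous X.bc ∧
        (∀ z, X.de z = -qφ z) ∧
        ∀ Y, QPTorus.IsAdjointSolution f p T ρ v k kp 0 1 Y → Continuous Y.bc → Y = X) ∧
    -- the linearized problem has no bounded inverse
    ¬ ∃ C : ℝ, QPTorus.LinearizationBound f p T ρ v k kp C := by
  have hfx : ContDiff ℝ 1 fun y => f y p := hf.comp (contDiff_id.prodMk contDiff_const)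
  have hτ := hv.isInvariantField_dTau hfx
  have hφ := hv.isInvariantField_dPhi hfx
  have hli := QPTorus.linearIndependent_of_det_phaseMatrix_ne_zero
    (QPTorus.continuous_jacobian hfx T v) hρ hτ hφ hnondeg
  have hsol : ∀ (ηT ηρ : ℝ) (X : QPTorus.AdjointVars n m),
      QPTorus.IsAdjointSolution f p T ρ v k kp ηT ηρ X → Continuous X.bc →
        X.ps = 0 ∧ ∀ z, X.de z = (T * ηT) • qτ z - ηρ • qφ z := fun ηT ηρ X hX hbc =>
    have hps := hX.ps_eq_zero hbc hτ hφ hnondeg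
    ⟨hps, hX.de_eq hbc hps hρ hv hfx hV hnh hli⟩
  have hexistsUnique : ∀ ηT ηρ : ℝ, ∃ X : QPTorus.AdjointVars n m,
      QPTorus.IsAdjointSolution f p T ρ v k kp ηT ηρ X ∧ Continuous X.de ∧ Continuous X.bc ∧
        (∀ z, X.de z = (T * ηT) • qτ z - ηρ • qφ z) ∧
        ∀ Y, QPTorus.IsAdjointSolution f p T ρ v k kp ηT ηρ Y → Continuous Y.bc → Y = X :=
    fun ηT ηρ => by
      obtain ⟨X, hX, hde, hcont, hbc, hps⟩ :=
        hnh.exists_isAdjointSolution hv hf hV hli k kp ηT ηρ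
      refine ⟨X, hX, hcont, hbc, congrFun hde, fun Y hY hYbc => ?_⟩
      obtain ⟨hYps, hYde⟩ := hsol ηT ηρ Y hY hYbc
      exact hY.eq_of_de_eq hX ((funext hYde).trans hde.symm) (hYps.trans hps.symm)
  refine ⟨hsol, ?_, ?_, QPTorus.not_linearizationBound hv hfx hli hnondeg⟩
  · simpa only [mul_one, zero_smul, sub_zero] using hexistsUnique 1 0
  · simpa only [mul_zero, zero_smul, one_smul, zero_sub] using hexistsUnique 0 1
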